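/- Let $X$ be one of the following compact smooth manifolds of real dimension $6$, each a quotient $\Gamma\backslash G$ of a Lie group $G$, with underlying complex manifold $\mathbb C^3$, by a discrete cocompact subgroup $\Gamma$ acting by left translations: * the torus $T^6$: $G=(\mathbb C^3,+)$ and $\Gamma=\mathbb Z[i]^3$; * the Iwasawa manifold: $G$ is the group of matrices $\begin{pmatrix}1&z_1&z_3\\0&1&z_2\\0&0&1\end{pmatrix}$, $z_1,z_2,z_3\in\mathbb C$, and $\Gamma$ is the subgroup of those with $z_1,z_2,z_3\in\mathbb Z[i]$; * the holomorphically parallelizable Nakamura manifold: $G=\mathbb C\ltimes\mathbb C^2$ with product $(z_1,z_2,z_3)(w_1,w_2,w_3)=(z_1+w_1,\;z_2+e^{z_1}w_2,\;z_3+e^{-z_1}w_3)$, and $\Gamma$ is any discrete cocompact subgroup of $G$. Let $J_0$ be the standard complex structure of $X$, that is, the one for which the projection $\mathbb C^3=G\to X$ is holomorphic. For a smooth almost complex structure $J$ on $X$ let $\bar\mu_J=\pi^{0,2}\circ d\colon A^{1,0}\to A^{0,2}$. This operator is linear over smooth functions. The rank of $J$ (or of its Nijenhuis tensor) at a point $x\in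 X$ means the complex rank of $\bar\mu_J\colon A^{1,0}_x\to A^{0,2}_x$. Then $J_0$ is integrable, and for every $k\in\{0,1,2,3\}$ there are $\varepsilon>0$ and a curve $J(s)$, $s\in\mathbb C$, $|s|<\varepsilon$, of almost complex structures on $X$, smooth jointly in $s$ and in the point of $X$, such that 1. $J(0)=J_0$; 2. $\bar\mu_{J(s)}$ has constant rank $k$ on $X$ for all $s$ with $0<|s|<\varepsilon$. In particular, for every $k\in\{0,1,2,3\}$, each neighborhood of $J_0$ in the $C^\infty$ topology contains an almost complex structure on $X$ whose Nijenhuis tensor has constant rank $k$. -/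

import Mathlib

open scoped Manifold ContDiff Topology Bundle

noncomputable section

/-- The model space `ℂ³`; as a real normed space it has dimension six. -/
abbrev C3 : Type := Fin 3 → ℂ

/-- Multiplication by `i` on `ℂ³`. -/
def mulI (z : C3) : C3 := Complex.I • z

/-! ### Almost complex structures on smooth six-manifolds -/

section AlmostComplex

variable (M : Type) [TopologicalSpace M] [ChartedSpace C3 M] [IsManifold 𝓘(ℝ, C3) ∞ M]

/-- A smooth almost complex structure on a smooth real six-manifold: a smooth section `J` of
`End(TM)` such that `J² = -id`. -/
structure AlmostComplexStructure where
  toFun : ∀ x : M, TangentSpace 𝓘(ℝ, C3) x →L[ℝ] TangentSpace 𝓘(ℝ, C3) x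
  sq_eq_neg : ∀ (x : M) (v : TangentSpace 𝓘(ℝ, C3) x), toFun x (toFun x v) = -v
  smooth : ContMDiff 𝓘(ℝ, C3) (𝓘(ℝ, C3).prod 𝓘(ℝ, C3 →L[ℝ] C3)) ∞
    (fun x : M => Bundle.TotalSpace.mk' (C3 →L[ℝ] C3)
      (E := fun x : M => TangentSpace 𝓘(ℝ, C3) x →L[ℝ] TangentSpace 𝓘(ℝ, C3) x) x (toFun x))

/-- A complex-valued 1-form on `M` (no regularity imposed). -/
abbrev OneForm : Type := ∀ x : M, TangentSpace 𝓘(ℝ, C3) x →L[ℝ] ℂ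

/-- Complex-valued functions of two tangent vectors at `x`; complex 2-forms at `x`, regarded as
such functions, live in this complex vector space. -/
abbrev TwoCovector (x : M) : Type :=
  TangentSpace 𝓘(ℝ, C3) x → TangentSpace 𝓘(ℝ, C3) x → ℂ

variable {M}

/-- A 1-form is smooth on `U` if it is smooth as a section of `Hom_ℝ(TM, ℂ)`. -/
def OneForm.SmoothOn (α : OneForm M) (U : Set M) : Prop :=
  ContMDiffOn 𝓘(ℝ, C3) (𝓘(ℝ, C3).prod 𝓘(ℝ, C3 →L[ℝ] ℂ)) ∞
    (fun x : M => Bundle.TotalSpace.mk' (C3 →L[ℝ] ℂ)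
      (E := fun x : M => TangentSpace 𝓘(ℝ, C3) x →L[ℝ] Bundle.Trivial M ℂ x) x (α x)) U

/-- The expression of a 1-form in the preferred chart at `x₀`, that is, its pullback under the
inverse of this chart. -/
def OneForm.inChart (α : OneForm M) (x₀ : M) (y : C3) : C3 →L[ℝ] ℂ :=
  (α ((extChartAt 𝓘(ℝ, C3) x₀).symm y)).comp
    (mfderiv 𝓘(ℝ, C3) 𝓘(ℝ, C3) (extChartAt 𝓘(ℝ, C3) x₀).symm y)

/-- The exterior derivative of a 1-form at `x`, computed in the preferred chart `φ` at `x`: with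
`a` the expression of the form in this chart and `D` the derivative of `a` at `φ x`,
`(dα)_x (v, w) = (D v') w' - (D w') v'`, where `v' = dφ_x v` and `w' = dφ_x w`. -/
def OneForm.extDerivAt (α : OneForm M) (x : M) : TwoCovector M x :=
  fun v w =>
    let D : C3 →L[ℝ] C3 →L[ℝ] ℂ := fderiv ℝ (α.inChart x) (extChartAt 𝓘(ℝ, C3) x x)
    let v' : C3 := mfderiv 𝓘(ℝ, C3) 𝓘(ℝ, C3) (extChartAt 𝓘(ℝ, C3) x) x v
    let w' : C3 := mfderiv 𝓘(ℝ, C3) 𝓘(ℝ, C3) (extChartAt 𝓘(ℝ, C3) x) x w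
    D v' w' - D w' v'

namespace AlmostComplexStructure

/-- `α` is of type `(1,0)` with respect to `J` on the set `U`: `α ∘ J = i α`. -/
def IsOneZeroOn (J : AlmostComplexStructure M) (α : OneForm M) (U : Set M) : Prop :=
  ∀ x ∈ U, ∀ v : TangentSpace 𝓘(ℝ, C3) x, α x (J.toFun x v) = Complex.I * α x v

/-- The projection of a complex 2-form at `x` onto its `(0,2)`-component with respect to `J`.
The `(0,1)`-component of a tangent vector `v` is `(v + i J v) / 2`, and
`β^{0,2}(v, w) = β(v^{0,1}, w^{0,1})`, where `β` is extended complex bilinearly to the complexified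
tangent space; expanding gives the formula below. -/
def proj02 (J : AlmostComplexStructure M) (x : M) (β : TwoCovector M x) : TwoCovector M x :=
  fun v w =>
    (1 / 4 : ℂ) * (β v w + Complex.I * β (J.toFun x v) w + Complex.I * β v (J.toFun x w)
      - β (J.toFun x v) (J.toFun x w))

/-- The operator `μ̄ = π^{0,2} ∘ d`, evaluated at `x`. -/
def muBar (J : AlmostComplexStructure M) (α : OneForm M) (x : M) : TwoCovector M x :=
  J.proj02 x (α.extDerivAt x)

/-- The image of `μ̄ : A^{1,0}_x → A^{0,2}_x`: the values at `x` of `μ̄ α`, for `α` a smooth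
`(1,0)`-form defined near `x`. -/
def muBarRange (J : AlmostComplexStructure M) (x : M) : Submodule ℂ (TwoCovector M x) :=
  Submodule.span ℂ {β | ∃ (U : Set M) (α : OneForm M), IsOpen U ∧ x ∈ U ∧ α.SmoothOn U ∧
    J.IsOneZeroOn α U ∧ β = J.muBar α x}

/-- The rank of `J` at `x`: the complex rank of `μ̄ : A^{1,0}_x → A^{0,2}_x`. -/
def rank (J : AlmostComplexStructure M) (x : M) : ℕ :=
  Module.finrank ℂ (J.muBarRange x)

/-- `J` (equivalently `μ̄`, or the Nijenhuis tensor) has constant rank `k`. -/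
def HasConstantRank (J : AlmostComplexStructure M) (k : ℕ) : Prop :=
  ∀ x : M, J.rank x = k

/-- `J` is integrable: around every point there is a smooth chart with values in `ℂ³` whose
differential intertwines `J` with multiplication by `i`. -/
def IsIntegrable (J : AlmostComplexStructure M) : Prop :=
  ∀ x : M, ∃ e ∈ IsManifold.maximalAtlas 𝓘(ℝ, C3) ∞ M, x ∈ e.source ∧
    ∀ p ∈ e.source, ∀ v : TangentSpace 𝓘(ℝ, C3) p,
      mfderiv 𝓘(ℝ, C3) 𝓘(ℝ, C3) e p (J.toFun p v) =
        mulI (mfderiv 𝓘(ℝ, C3) 𝓘(ℝ, C3) e p v)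

/-- The expression of `J` in the preferred chart at `x₀`, as a matrix-valued function. -/
def inChart (J : AlmostComplexStructure M) (x₀ : M) (y : C3) : C3 →L[ℝ] C3 :=
  ((mfderiv 𝓘(ℝ, C3) 𝓘(ℝ, C3) (extChartAt 𝓘(ℝ, C3) x₀)
        ((extChartAt 𝓘(ℝ, C3) x₀).symm y)).comp
      (J.toFun ((extChartAt 𝓘(ℝ, C3) x₀).symm y))).comp
    (mfderiv 𝓘(ℝ, C3) 𝓘(ℝ, C3) (extChartAt 𝓘(ℝ, C3) x₀).symm y)

/-- The `C^∞` topology on almost complex structures: uniform convergence, on compact subsets of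
the domains of the charts, of all derivatives of the expressions in charts. -/
instance : TopologicalSpace (AlmostComplexStructure M) :=
  ⨅ (x₀ : M) (r : ℕ), TopologicalSpace.induced
    (fun J => UniformOnFun.ofFun {K : Set C3 | IsCompact K ∧ K ⊆ (extChartAt 𝓘(ℝ, C3) x₀).target}
      (iteratedFDeriv ℝ r (J.inChart x₀)))
    inferInstance

/-- `J(s)`, `|s| < ε`, is a smooth curve of almost complex structures with complex parameter `s`:
it is jointly smooth in `s` and in the point of `M`. -/
def IsSmoothCurve (J : ℂ → AlmostComplexStructure M) (ε : ℝ) : Prop :=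
  ContMDiffOn (𝓘(ℝ, ℂ).prod 𝓘(ℝ, C3)) (𝓘(ℝ, C3).prod 𝓘(ℝ, C3 →L[ℝ] C3)) ∞
    (fun p : ℂ × M => Bundle.TotalSpace.mk' (C3 →L[ℝ] C3)
      (E := fun x : M => TangentSpace 𝓘(ℝ, C3) x →L[ℝ] TangentSpace 𝓘(ℝ, C3) x)
      p.2 ((J p.1).toFun p.2))
    (Metric.ball (0 : ℂ) ε ×ˢ Set.univ)

end AlmostComplexStructure

end AlmostComplex

/-! ### Quotients of Lie groups by discrete subgroups -/

section Quotient

theorem properlyDiscontinuousSMul_of_discrete {G : Type} [Group G] [TopologicalSpace G]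
    [T2Space G] [ChartedSpace C3 G] [LieGroup 𝓘(ℝ, C3) ∞ G]
    (Γ : Subgroup G) [DiscreteTopology Γ] :
    ProperlyDiscontinuousSMul Γ G := by
  have : IsTopologicalGroup G := topologicalGroup_of_lieGroup 𝓘(ℝ, C3) ∞
  exact Γ.properlyDiscontinuousSMul_of_tendsto_cofinite
    (Γ.tendsto_coe_cofinite_of_discrete (isDiscrete_iff_discreteTopology.mpr inferInstance))

theorem continuousConstSMul_of_lieGroup {G : Type} [Group G] [TopologicalSpace G]
    [ChartedSpace C3 G] [LieGroup 𝓘(ℝ, C3) ∞ G] (Γ : Subgroup G) : ContinuousConstSMul Γ G := by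
  have : IsTopologicalGroup G := topologicalGroup_of_lieGroup 𝓘(ℝ, C3) ∞
  infer_instance

variable {G : Type} [Group G] [TopologicalSpace G] [ChartedSpace C3 G]
  [LieGroup 𝓘(ℝ, C3) ∞ G] [T2Space G] [LocallyCompactSpace G]

/-- The space `Γ \ G` of orbits of the action of a subgroup `Γ` on `G` by left translations. -/
def LeftQuotient (Γ : Subgroup G) : Type := MulAction.orbitRel.Quotient Γ G

/-- The projection `G → Γ \ G`. -/
def LeftQuotient.proj (Γ : Subgroup G) (g : G) : LeftQuotient Γ :=
  Quotient.mk (MulAction.orbitRel Γ G) g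

instance (Γ : Subgroup G) : TopologicalSpace (LeftQuotient Γ) :=
  inferInstanceAs (TopologicalSpace (MulAction.orbitRel.Quotient Γ G))

/-- The atlas of `Γ \ G`, for `Γ` discrete: local inverses of the projection `G → Γ \ G` followed
by charts of `G`. -/
instance (Γ : Subgroup G) [DiscreteTopology Γ] : ChartedSpace C3 (LeftQuotient Γ) :=
  have := properlyDiscontinuousSMul_of_discrete Γ
  have := continuousConstSMul_of_lieGroup Γ
  inferInstanceAs (ChartedSpace C3 (MulAction.orbitRel.Quotient Γ G))

instance (Γ : Subgroup G) [DiscreteTopology Γ] :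
    IsManifold 𝓘(ℝ, C3) ∞ (LeftQuotient Γ) := by
  have := properlyDiscontinuousSMul_of_discrete Γ
  have := continuousConstSMul_of_lieGroup Γ
  have hq : IsQuotientCoveringMap (Quotient.mk (MulAction.orbitRel Γ G)) Γ :=
    isQuotientCoveringMap_quotientMk_of_properlyDiscontinuousSMul
  have hl := hq.isCoveringMap.isLocalHomeomorph
  have key : ∀ (a a' : G) (c c' : OpenPartialHomeomorph G C3), c ∈ atlas C3 G → c' ∈ atlas C3 G →
      ContDiffOn ℝ ∞ (((hl.localInverseAt a).trans c).symm.trans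
        ((hl.localInverseAt a').trans c'))
        (((hl.localInverseAt a).trans c).symm.trans ((hl.localInverseAt a').trans c')).source := by
    intro a a' c c' hc hc' y hy
    simp only [OpenPartialHomeomorph.trans_source, OpenPartialHomeomorph.symm_source,
      OpenPartialHomeomorph.trans_target, Set.mem_inter_iff, Set.mem_preimage,
      OpenPartialHomeomorph.coe_trans_symm, Function.comp_apply,
      IsLocalHomeomorph.localInverseAt_symm] at hy
    obtain ⟨⟨hy1, hy2⟩, hy3, hy4⟩ := hy
    set m := c.symm y with hm
    set l' := hl.localInverseAt a' with hl'
    obtain ⟨g, hg⟩ : l' (Quotient.mk _ m) ∈ MulAction.orbit Γ m :=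
      hq.apply_eq_iff_mem_orbit.mp (hl.apply_localInverseAt_of_mem hy3)
    have hg' : g • m = l' (Quotient.mk _ m) := hg
    have hcs : ContMDiffAt 𝓘(ℝ, C3) 𝓘(ℝ, C3) ∞ c.symm y :=
      contMDiffOn_symm_of_mem_maximalAtlas (IsManifold.subset_maximalAtlas hc) |>.contMDiffAt
        (c.open_target.mem_nhds hy1)
    have hc2 : ContMDiffAt 𝓘(ℝ, C3) 𝓘(ℝ, C3) ∞ c' (g • m) :=
      contMDiffAt_of_mem_maximalAtlas (IsManifold.subset_maximalAtlas hc') (hg' ▸ hy4)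
    have hmul : ContMDiff 𝓘(ℝ, C3) 𝓘(ℝ, C3) ∞ (fun x : G => g • x) :=
      contMDiff_mul_left (a := (g : G))
    have hcomp : ContMDiffAt 𝓘(ℝ, C3) 𝓘(ℝ, C3) ∞ (fun y => c' (g • c.symm y)) y :=
      ContMDiffAt.comp y (g := fun x => c' (g • x)) (f := c.symm)
        (ContMDiffAt.comp m (g := c') hc2 (hmul m)) hcs
    refine ((contMDiffAt_iff_contDiffAt.mp hcomp).congr_of_eventuallyEq ?_).contDiffWithinAt
    have hcont : ContinuousAt (fun y => g • c.symm y) y :=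
      (continuous_const_smul g).continuousAt.comp (c.continuousAt_symm hy1)
    have hmem : g • c.symm y ∈ l'.target := by
      rw [← hm, hg']; exact l'.map_source hy3
    filter_upwards [hcont.preimage_mem_nhds (l'.open_target.mem_nhds hmem)] with z hz
    simp only [OpenPartialHomeomorph.coe_trans, OpenPartialHomeomorph.coe_trans_symm,
      Function.comp_apply, IsLocalHomeomorph.localInverseAt_symm]
    congr 1
    have h1 := l'.right_inv hz
    rw [hl', IsLocalHomeomorph.localInverseAt_symm, ← hl', hq.map_smul] at h1
    exact h1
  apply isManifold_of_contDiffOn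
  rintro e e' ⟨q, rfl⟩ ⟨q', rfl⟩
  simp only [modelWithCornersSelf_coe, modelWithCornersSelf_coe_symm, Set.range_id,
    Set.preimage_id, Set.inter_univ, Function.id_comp, Function.comp_id]
  exact key _ _ _ _ (chart_mem_atlas C3 _) (chart_mem_atlas C3 _)

/-- `J₀` is the complex structure induced on `Γ \ G` by that of `G`: the projection `G → Γ \ G` is
holomorphic, that is, its differential intertwines multiplication by `i` with `J₀`. (Used for the
groups below, which are `ℂ³` with the identity as their only preferred chart, so that a tangent
vector of `G` is a vector of `ℂ³` in the global coordinates.) -/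
def IsStandard {Γ : Subgroup G} [DiscreteTopology Γ]
    (J₀ : AlmostComplexStructure (LeftQuotient Γ)) : Prop :=
  ∀ (g : G) (v : C3),
    J₀.toFun (LeftQuotient.proj Γ g)
        (mfderiv 𝓘(ℝ, C3) 𝓘(ℝ, C3) (LeftQuotient.proj Γ) g v) =
      mfderiv 𝓘(ℝ, C3) 𝓘(ℝ, C3) (LeftQuotient.proj Γ) g (mulI v)

/-- The standard complex structure `J₀` of `X = Γ \ G` is integrable; for every `k ∈ {0,1,2,3}` it
is the value at `s = 0` of a smooth curve `J(s)`, `|s| < ε`, of almost complex structures on `X`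
such that `J(s)` has constant rank `k` for `0 < |s| < ε`; and every `C^∞`-neighbourhood of `J₀`
contains, for every `k ∈ {0,1,2,3}`, an almost complex structure of constant rank `k`. -/
def HasConstantRankCurves (Γ : Subgroup G) [DiscreteTopology Γ] : Prop :=
  ∃ J₀ : AlmostComplexStructure (LeftQuotient Γ), IsStandard J₀ ∧ J₀.IsIntegrable ∧
    (∀ k : ℕ, k ≤ 3 → ∃ ε : ℝ, 0 < ε ∧ ∃ J : ℂ → AlmostComplexStructure (LeftQuotient Γ),
      AlmostComplexStructure.IsSmoothCurve J ε ∧ J 0 = J₀ ∧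
      ∀ s : ℂ, s ≠ 0 → ‖s‖ < ε → (J s).HasConstantRank k) ∧
    (∀ U ∈ 𝓝 J₀, ∀ k : ℕ, k ≤ 3 → ∃ J ∈ U, J.HasConstantRank k)

end Quotient

/-! ### The three groups -/

theorem contMDiff_prod_of_contDiff {F : C3 × C3 → C3} (h : ContDiff ℝ ∞ F) :
    ContMDiff (𝓘(ℝ, C3).prod 𝓘(ℝ, C3)) 𝓘(ℝ, C3) ∞ F := by
  have h' := h.contMDiff
  rwa [modelWithCornersSelf_prod, ← chartedSpaceSelf_prod] at h'

/-- The points of `ℂ³` all of whose coordinates are Gaussian integers. -/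
def gaussianPoints : Set C3 := {z | ∀ j, ∃ a : GaussianInt, z j = GaussianInt.toComplex a}

theorem isDiscrete_gaussianPoints : IsDiscrete gaussianPoints := by
  rw [isDiscrete_iff_discreteTopology]
  refine DiscreteTopology.of_forall_le_dist one_pos ?_
  rintro ⟨z, hz⟩ ⟨w, hw⟩ hne
  obtain ⟨j, hj⟩ : ∃ j, z j ≠ w j := by
    by_contra! h
    exact hne (Subtype.ext (funext h))
  obtain ⟨a, ha⟩ := hz j
  obtain ⟨b, hb⟩ := hw j
  refine le_trans ?_ (dist_le_pi_dist z w j)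
  have hab : a - b ≠ 0 := by
    intro h
    exact hj (by rw [ha, hb, sub_eq_zero.mp h])
  rw [dist_eq_norm, ha, hb, ← map_sub]
  have h1 : (1 : ℤ) ≤ (a - b).norm := by
    have := GaussianInt.norm_pos.mpr hab
    omega
  have h2 : Complex.normSq (GaussianInt.toComplex (a - b)) = ((a - b).norm : ℝ) := by
    simp [GaussianInt.intCast_real_norm]
  have h3 : (1 : ℝ) ≤ ((a - b).norm : ℝ) := by exact_mod_cast h1
  rw [← h2, Complex.normSq_eq_norm_sq] at h3
  nlinarith [norm_nonneg (GaussianInt.toComplex (a - b))]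

/-- The additive group `ℂ³` (with its group law written multiplicatively). -/
def VectorGroup : Type := Fin 3 → ℂ

namespace VectorGroup

instance : TopologicalSpace VectorGroup := inferInstanceAs (TopologicalSpace C3)
instance : T2Space VectorGroup := inferInstanceAs (T2Space C3)
instance : LocallyCompactSpace VectorGroup := inferInstanceAs (LocallyCompactSpace C3)
instance : ChartedSpace C3 VectorGroup := inferInstanceAs (ChartedSpace C3 C3)
instance : IsManifold 𝓘(ℝ, C3) ∞ VectorGroup := inferInstanceAs (IsManifold 𝓘(ℝ, C3) ∞ C3)

/-- The group law. -/
def mul (z w : C3) : C3 :=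
  ![z 0 + w 0, z 1 + w 1, z 2 + w 2]

/-- The inverse. -/
def inv (z : C3) : C3 :=
  ![-z 0, -z 1, -z 2]

instance : Group VectorGroup where
  mul := mul
  one := (0 : C3)
  inv := inv
  mul_assoc a b c := by
    change mul (mul a b) c = mul a (mul b c)
    funext j; fin_cases j <;> simp [mul] <;> ring
  one_mul a := by
    change mul (0 : C3) a = a
    funext j; fin_cases j <;> simp [mul]
  mul_one a := by
    change mul a (0 : C3) = a
    funext j; fin_cases j <;> simp [mul]
  inv_mul_cancel a := by
    change mul (inv a) a = (0 : C3)
    funext j; fin_cases j <;> simp [mul, inv]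

instance : LieGroup 𝓘(ℝ, C3) ∞ VectorGroup where
  contMDiff_mul := by
    refine contMDiff_prod_of_contDiff (F := fun p : C3 × C3 => mul p.1 p.2) ?_
    rw [contDiff_pi]
    intro j; fin_cases j <;> simp [mul] <;> fun_prop
  contMDiff_inv := by
    refine ContDiff.contMDiff (f := fun p : C3 => inv p) ?_
    rw [contDiff_pi]
    intro j; fin_cases j <;> simp [inv] <;> fun_prop

/-- The lattice `ℤ[i]³`. -/
def lattice : Subgroup VectorGroup where
  carrier := gaussianPoints
  one_mem' j := ⟨0, by simp; rfl⟩
  mul_mem' {z w} hz hw := by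
    choose a ha using hz
    choose b hb using hw
    intro j
    refine ⟨a j + b j, ?_⟩
    change mul z w j = _
    fin_cases j <;> simp [mul, ha, hb]
  inv_mem' {z} hz := by
    choose a ha using hz
    intro j
    refine ⟨-a j, ?_⟩
    change inv z j = _
    fin_cases j <;> simp [inv, ha]

instance : DiscreteTopology lattice := isDiscrete_gaussianPoints.to_subtype

end VectorGroup

/-- The complex Heisenberg group of upper unitriangular complex `3 × 3` matrices, in the global
coordinates in which `(z₁, z₂, z₃)` stands for the matrix with rows `(1, z₁, z₃)`, `(0, 1, z₂)`,
`(0, 0, 1)`. See `toMatrix_mul`: the group law is matrix multiplication. -/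
def ComplexHeisenberg : Type := Fin 3 → ℂ

namespace ComplexHeisenberg

instance : TopologicalSpace ComplexHeisenberg := inferInstanceAs (TopologicalSpace C3)
instance : T2Space ComplexHeisenberg := inferInstanceAs (T2Space C3)
instance : LocallyCompactSpace ComplexHeisenberg := inferInstanceAs (LocallyCompactSpace C3)
instance : ChartedSpace C3 ComplexHeisenberg := inferInstanceAs (ChartedSpace C3 C3)
instance : IsManifold 𝓘(ℝ, C3) ∞ ComplexHeisenberg := inferInstanceAs (IsManifold 𝓘(ℝ, C3) ∞ C3)

/-- The group law. -/
def mul (z w : C3) : C3 :=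
  ![z 0 + w 0, z 1 + w 1, z 2 + w 2 + z 0 * w 1]

/-- The inverse. -/
def inv (z : C3) : C3 :=
  ![-z 0, -z 1, -z 2 + z 0 * z 1]

instance : Group ComplexHeisenberg where
  mul := mul
  one := (0 : C3)
  inv := inv
  mul_assoc a b c := by
    change mul (mul a b) c = mul a (mul b c)
    funext j; fin_cases j <;> simp [mul] <;> ring
  one_mul a := by
    change mul (0 : C3) a = a
    funext j; fin_cases j <;> simp [mul]
  mul_one a := by
    change mul a (0 : C3) = a
    funext j; fin_cases j <;> simp [mul]
  inv_mul_cancel a := by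
    change mul (inv a) a = (0 : C3)
    funext j; fin_cases j <;> simp [mul, inv]

instance : LieGroup 𝓘(ℝ, C3) ∞ ComplexHeisenberg where
  contMDiff_mul := by
    refine contMDiff_prod_of_contDiff (F := fun p : C3 × C3 => mul p.1 p.2) ?_
    rw [contDiff_pi]
    intro j; fin_cases j <;> simp [mul] <;> fun_prop
  contMDiff_inv := by
    refine ContDiff.contMDiff (f := fun p : C3 => inv p) ?_
    rw [contDiff_pi]
    intro j; fin_cases j <;> simp [inv] <;> fun_prop

/-- The unitriangular matrix with coordinates `z`. -/
def toMatrix (z : ComplexHeisenberg) : Matrix (Fin 3) (Fin 3) ℂ :=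
  !![1, z 0, z 2; 0, 1, z 1; 0, 0, 1]

theorem toMatrix_mul (z w : ComplexHeisenberg) : toMatrix (z * w) = toMatrix z * toMatrix w := by
  change toMatrix (mul z w) = _
  ext i j
  fin_cases i <;> fin_cases j <;> simp [toMatrix, mul, Matrix.mul_apply, Fin.sum_univ_three] <;> ring

/-- The subgroup of matrices with entries in `ℤ[i]`. -/
def lattice : Subgroup ComplexHeisenberg where
  carrier := gaussianPoints
  one_mem' j := ⟨0, by simp; rfl⟩
  mul_mem' {z w} hz hw := by
    choose a ha using hz
    choose b hb using hw
    intro j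
    refine ⟨(![a 0 + b 0, a 1 + b 1, a 2 + b 2 + a 0 * b 1] : Fin 3 → GaussianInt) j, ?_⟩
    change mul z w j = _
    fin_cases j <;> simp [mul, ha, hb]
  inv_mem' {z} hz := by
    choose a ha using hz
    intro j
    refine ⟨(![-a 0, -a 1, -a 2 + a 0 * a 1] : Fin 3 → GaussianInt) j, ?_⟩
    change inv z j = _
    fin_cases j <;> simp [inv, ha]

instance : DiscreteTopology lattice := isDiscrete_gaussianPoints.to_subtype

end ComplexHeisenberg

/-- The solvable group `ℂ ⋉ ℂ²`, where `z₁ ∈ ℂ` acts on `ℂ²` by the diagonal matrix with entries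
`exp z₁` and `exp (-z₁)`. -/
def NakamuraGroup : Type := Fin 3 → ℂ

namespace NakamuraGroup

instance : TopologicalSpace NakamuraGroup := inferInstanceAs (TopologicalSpace C3)
instance : T2Space NakamuraGroup := inferInstanceAs (T2Space C3)
instance : LocallyCompactSpace NakamuraGroup := inferInstanceAs (LocallyCompactSpace C3)
instance : ChartedSpace C3 NakamuraGroup := inferInstanceAs (ChartedSpace C3 C3)
instance : IsManifold 𝓘(ℝ, C3) ∞ NakamuraGroup := inferInstanceAs (IsManifold 𝓘(ℝ, C3) ∞ C3)

/-- The group law. -/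
def mul (z w : C3) : C3 :=
  ![z 0 + w 0, z 1 + Complex.exp (z 0) * w 1, z 2 + Complex.exp (-z 0) * w 2]

/-- The inverse. -/
def inv (z : C3) : C3 :=
  ![-z 0, -(Complex.exp (-z 0) * z 1), -(Complex.exp (z 0) * z 2)]

instance : Group NakamuraGroup where
  mul := mul
  one := (0 : C3)
  inv := inv
  mul_assoc a b c := by
    change mul (mul a b) c = mul a (mul b c)
    funext j; fin_cases j <;> simp [mul, Complex.exp_add, add_comm] <;> ring
  one_mul a := by
    change mul (0 : C3) a = a
    funext j; fin_cases j <;> simp [mul]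
  mul_one a := by
    change mul a (0 : C3) = a
    funext j; fin_cases j <;> simp [mul]
  inv_mul_cancel a := by
    change mul (inv a) a = (0 : C3)
    funext j; fin_cases j <;> simp [mul, inv, add_comm]

instance : LieGroup 𝓘(ℝ, C3) ∞ NakamuraGroup where
  contMDiff_mul := by
    refine contMDiff_prod_of_contDiff (F := fun p : C3 × C3 => mul p.1 p.2) ?_
    rw [contDiff_pi]
    intro j; fin_cases j <;> simp [mul] <;> fun_prop
  contMDiff_inv := by
    refine ContDiff.contMDiff (f := fun p : C3 => inv p) ?_
    rw [contDiff_pi]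
    intro j; fin_cases j <;> simp [inv] <;> fun_prop

end NakamuraGroup

end

/-!
The proof deforms a holomorphic left-invariant coframe.

The three groups carry holomorphic left-invariant coframes `φ` of one common shape, `dz₁`,
`e^{-μ z₁} dz₂`, `e^{μ z₁} dz₃ - c z₁ dz₂`, with `(c, μ) = (0, 0)`, `(1, 0)`, `(0, 1)` for the
vector group, the Heisenberg group and the Nakamura group (`holoForm`). With `f = exp (2iκ Re z₁)`
and `g = exp (2iκ Re z₂)`, where `κ = π` for the first two groups, so that `f` and `g` are
invariant under the lattice of Gaussian points, and `κ = 0` for the last one, consider the coframe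
`σ = (φ₁ + ρ₁ f φ̄₂, φ₂ + ρ₂ f φ̄₃, φ₃ + ρ₃ g φ̄₃)` with real coefficients `ρ` (`coframe`).
If `|ρ₃| < 1` it is a coframe, and its components are the `(1,0)`-forms of an almost complex
structure, the pullback of multiplication by `i` under `σ` (`pullbackI`), which is `J₀` for `ρ = 0`.

The operator `μ̄` on `(1,0)`-forms is tensorial (`antiPart_flatExtDeriv_eq_zero`), so its image
at a point is spanned by the values of `μ̄` on the three components of `σ`
(`AlmostComplexStructure.muBarRange_eq_span`). To find them it suffices to evaluate `dσᵢ` on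
`(0,1)`-vectors. On these `σ` vanishes, so the values `q` of `φ̄` are free coordinates there and the
values of `φ` are given by `φ₁ = -ρ₁ f q₂`, `φ₂ = -ρ₂ f q₃`, `φ₃ = -ρ₃ g q₃`
(`antiVal_holoForm_add`, `exists_antiCoord_eq`). This yields closed formulas for the components of
`μ̄ σᵢ` along `qₐ ∧ q_b` (`antiPart_deformedForm_zero` and the two lemmas after it), which show that
the rank is the number of nonzero coefficients `ρᵢ` when these are small and suitably chosen
(`finrank_span_coframe`). Letting the nonzero coefficients be `|s|² / (1 + |s|²)` gives the curves.

For the passage to `Γ \ G`, the inverse of every preferred chart of the quotient is the projection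
itself, so that a `Γ`-invariant tensor on `ℂ³` and the tensor it induces on `Γ \ G` have the same
expression in every preferred chart (`descendEnd_inChart`). Smoothness, integrability of `J₀` and
convergence in the `C^∞` topology are read off from these expressions.
-/

open scoped ComplexConjugate

noncomputable section

/-! ### Forms and endomorphisms in preferred charts -/

section Charts

variable {M : Type} [TopologicalSpace M] [ChartedSpace C3 M] [IsManifold 𝓘(ℝ, C3) ∞ M]

theorem mfderiv_extChartAt_comp_mfderiv_symm (x₀ : M) {y : C3}
    (hy : y ∈ (extChartAt 𝓘(ℝ, C3) x₀).target) :
    (mfderiv 𝓘(ℝ, C3) 𝓘(ℝ, C3) (extChartAt 𝓘(ℝ, C3) x₀)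
      ((extChartAt 𝓘(ℝ, C3) x₀).symm y)).comp
      (mfderiv 𝓘(ℝ, C3) 𝓘(ℝ, C3) (extChartAt 𝓘(ℝ, C3) x₀).symm y) =
      ContinuousLinearMap.id ℝ C3 := by
  have : IsManifold 𝓘(ℝ, C3) 1 M := IsManifold.of_le (n := ∞) (by exact_mod_cast le_top)
  have h := mfderiv_extChartAt_comp_mfderivWithin_extChartAt_symm (I := 𝓘(ℝ, C3)) hy
  rw [modelWithCornersSelf_coe, Set.range_id, mfderivWithin_univ] at h
  exact h

theorem mfderiv_symm_comp_mfderiv_extChartAt (x₀ : M) {y : C3}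
    (hy : y ∈ (extChartAt 𝓘(ℝ, C3) x₀).target) :
    (mfderiv 𝓘(ℝ, C3) 𝓘(ℝ, C3) (extChartAt 𝓘(ℝ, C3) x₀).symm y).comp
      (mfderiv 𝓘(ℝ, C3) 𝓘(ℝ, C3) (extChartAt 𝓘(ℝ, C3) x₀)
      ((extChartAt 𝓘(ℝ, C3) x₀).symm y)) =
      ContinuousLinearMap.id ℝ C3 := by
  have : IsManifold 𝓘(ℝ, C3) 1 M := IsManifold.of_le (n := ∞) (by exact_mod_cast le_top)
  have h := mfderivWithin_extChartAt_symm_comp_mfderiv_extChartAt (I := 𝓘(ℝ, C3)) hy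
  rw [modelWithCornersSelf_coe, Set.range_id, mfderivWithin_univ] at h
  exact h

theorem mfderiv_extChartAt_base (x : M) :
    mfderiv 𝓘(ℝ, C3) 𝓘(ℝ, C3) (extChartAt 𝓘(ℝ, C3) x) x = ContinuousLinearMap.id ℝ C3 := by
  have : IsManifold 𝓘(ℝ, C3) 1 M := IsManifold.of_le (n := ∞) (by exact_mod_cast le_top)
  exact mfderiv_extChartAt_self

theorem mfderiv_extChartAt_symm_base (x : M) :
    mfderiv 𝓘(ℝ, C3) 𝓘(ℝ, C3) (extChartAt 𝓘(ℝ, C3) x).symm (extChartAt 𝓘(ℝ, C3) x x) =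
      ContinuousLinearMap.id ℝ C3 := by
  have : IsManifold 𝓘(ℝ, C3) 1 M := IsManifold.of_le (n := ∞) (by exact_mod_cast le_top)
  have h := mfderivWithin_range_extChartAt_symm (I := 𝓘(ℝ, C3)) (x := x)
  rw [modelWithCornersSelf_coe, Set.range_id, mfderivWithin_univ] at h
  exact h

theorem inCoordinates_end (x₀ y : M) (hy : y ∈ (chartAt C3 x₀).source)
    (T : TangentSpace 𝓘(ℝ, C3) y →L[ℝ] TangentSpace 𝓘(ℝ, C3) y) :
    ContinuousLinearMap.inCoordinates C3 (fun x : M => TangentSpace 𝓘(ℝ, C3) x)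
      C3 (fun x : M => TangentSpace 𝓘(ℝ, C3) x) x₀ y x₀ y T =
    ((mfderiv 𝓘(ℝ, C3) 𝓘(ℝ, C3) (extChartAt 𝓘(ℝ, C3) x₀) y).comp T).comp
      (mfderiv 𝓘(ℝ, C3) 𝓘(ℝ, C3) (extChartAt 𝓘(ℝ, C3) x₀).symm
        (extChartAt 𝓘(ℝ, C3) x₀ y)) := by
  have : IsManifold 𝓘(ℝ, C3) 1 M := IsManifold.of_le (n := ∞) (by exact_mod_cast le_top)
  have h1 := TangentBundle.continuousLinearMapAt_trivializationAt (I := 𝓘(ℝ, C3)) hy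
  have h2 := TangentBundle.symmL_trivializationAt (I := 𝓘(ℝ, C3)) hy
  rw [modelWithCornersSelf_coe, Set.range_id, mfderivWithin_univ] at h2
  rw [ContinuousLinearMap.inCoordinates, h1, h2]
  rfl

theorem inCoordinates_form (x₀ y : M) (hy : y ∈ (chartAt C3 x₀).source)
    (T : TangentSpace 𝓘(ℝ, C3) y →L[ℝ] ℂ) :
    ContinuousLinearMap.inCoordinates C3 (fun x : M => TangentSpace 𝓘(ℝ, C3) x)
      ℂ (Bundle.Trivial M ℂ) x₀ y x₀ y T =
    T.comp (mfderiv 𝓘(ℝ, C3) 𝓘(ℝ, C3) (extChartAt 𝓘(ℝ, C3) x₀).symm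
        (extChartAt 𝓘(ℝ, C3) x₀ y)) := by
  have : IsManifold 𝓘(ℝ, C3) 1 M := IsManifold.of_le (n := ∞) (by exact_mod_cast le_top)
  have h2 := TangentBundle.symmL_trivializationAt (I := 𝓘(ℝ, C3)) hy
  rw [modelWithCornersSelf_coe, Set.range_id, mfderivWithin_univ] at h2
  rw [ContinuousLinearMap.inCoordinates, h2]
  ext v
  simp
  rfl

theorem OneForm.SmoothOn.contDiffAt_inChart {α : OneForm M} {U : Set M} (h : α.SmoothOn U)
    (hU : IsOpen U) {x : M} (hx : x ∈ U) :
    ContDiffAt ℝ ∞ (α.inChart x) (extChartAt 𝓘(ℝ, C3) x x) := by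
  have h1 := (h x hx).contMDiffAt (hU.mem_nhds hx)
  have h2 := ((contMDiffAt_hom_bundle _).1 h1).2
  rw [← contMDiffAt_iff_contDiffAt]
  have h3 : ContMDiffAt 𝓘(ℝ, C3) 𝓘(ℝ, C3) ∞ (extChartAt 𝓘(ℝ, C3) x).symm
      (extChartAt 𝓘(ℝ, C3) x x) :=
    (contMDiffOn_extChartAt_symm x).contMDiffAt (extChartAt_target_mem_nhds x)
  have h4 := ContMDiffAt.comp (extChartAt 𝓘(ℝ, C3) x x)
    (by rw [extChartAt_to_inv]; exact h2) h3
  refine h4.congr_of_eventuallyEq ?_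
  filter_upwards [extChartAt_target_mem_nhds (I := 𝓘(ℝ, C3)) x] with y hy
  have hs := (extChartAt 𝓘(ℝ, C3) x).map_target hy
  rw [extChartAt_source] at hs
  change _ = ContinuousLinearMap.inCoordinates C3 (fun x : M => TangentSpace 𝓘(ℝ, C3) x)
      ℂ (Bundle.Trivial M ℂ) x _ x _ _
  rw [inCoordinates_form x _ hs, (extChartAt 𝓘(ℝ, C3) x).right_inv hy]
  rfl

/-- The 1-form on a manifold whose expression in the preferred chart at `x₀` is `η`. -/
def OneForm.ofChart (x₀ : M) (η : C3 → C3 →L[ℝ] ℂ) : OneForm M := fun x =>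
  (η (extChartAt 𝓘(ℝ, C3) x₀ x)).comp
    (mfderiv 𝓘(ℝ, C3) 𝓘(ℝ, C3) (extChartAt 𝓘(ℝ, C3) x₀) x)

theorem OneForm.inChart_ofChart (x₀ : M) (η : C3 → C3 →L[ℝ] ℂ) {y : C3}
    (hy : y ∈ (extChartAt 𝓘(ℝ, C3) x₀).target) : (OneForm.ofChart x₀ η).inChart x₀ y = η y := by
  have h := mfderiv_extChartAt_comp_mfderiv_symm x₀ hy
  ext v
  have h' := DFunLike.congr_fun h v
  simp only [OneForm.inChart, OneForm.ofChart, (extChartAt 𝓘(ℝ, C3) x₀).right_inv hy]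
  exact congrArg (η y) h'

theorem OneForm.smoothOn_ofChart (x₀ : M) {η : C3 → C3 →L[ℝ] ℂ} (hη : ContDiff ℝ ∞ η) :
    (OneForm.ofChart x₀ η).SmoothOn (chartAt C3 x₀).source := by
  have hb : (trivializationAt (C3 →L[ℝ] ℂ)
    (fun x : M => TangentSpace 𝓘(ℝ, C3) x →L[ℝ] Bundle.Trivial M ℂ x) x₀).baseSet =
      (chartAt C3 x₀).source := by
    simp [hom_trivializationAt_baseSet]
  have key := (trivializationAt (C3 →L[ℝ] ℂ)
    (fun x : M => TangentSpace 𝓘(ℝ, C3) x →L[ℝ] Bundle.Trivial M ℂ x)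
      x₀).contMDiffOn_section_baseSet_iff (IB := 𝓘(ℝ, C3)) (n := ∞)
      (s := OneForm.ofChart x₀ η)
  rw [hb] at key
  refine key.2 ?_
  have h1 : ContMDiffOn 𝓘(ℝ, C3) 𝓘(ℝ, C3 →L[ℝ] ℂ) ∞
      (fun x => η (extChartAt 𝓘(ℝ, C3) x₀ x)) (chartAt C3 x₀).source :=
    hη.contMDiff.comp_contMDiffOn contMDiffOn_extChartAt
  refine h1.congr ?_
  intro y hy
  have hy' : y ∈ (extChartAt 𝓘(ℝ, C3) x₀).source := by rwa [extChartAt_source]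
  rw [hom_trivializationAt_apply]
  change ContinuousLinearMap.inCoordinates C3 (fun x : M => TangentSpace 𝓘(ℝ, C3) x)
      ℂ (Bundle.Trivial M ℂ) x₀ y x₀ y _ = _
  rw [inCoordinates_form x₀ y hy]
  have := OneForm.inChart_ofChart x₀ η ((extChartAt 𝓘(ℝ, C3) x₀).map_source hy')
  rw [OneForm.inChart, (extChartAt 𝓘(ℝ, C3) x₀).left_inv hy'] at this
  exact this

end Charts

/-! ### Tensoriality of the `(0,2)`-part of the differential -/

/-- The exterior derivative at `a` of a 1-form on `ℂ³`. -/
def flatExtDeriv (η : C3 → C3 →L[ℝ] ℂ) (a : C3) : C3 → C3 → ℂ := fun v w =>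
  fderiv ℝ η a v w - fderiv ℝ η a w v

/-- The `(0,2)`-component of a complex-valued real bilinear form on `ℂ³` with respect to the complex
structure `j`, by the formula that defines `AlmostComplexStructure.proj02`. -/
def antiPart (j : C3 →L[ℝ] C3) (β : C3 → C3 → ℂ) : C3 → C3 → ℂ := fun v w =>
  (1 / 4 : ℂ) * (β v w + Complex.I * β (j v) w + Complex.I * β v (j w) - β (j v) (j w))

theorem antiPart_flatExtDeriv_sum (j : C3 →L[ℝ] C3) {η : C3 → C3 →L[ℝ] ℂ}
    {θ : Fin 3 → C3 → C3 →L[ℝ] ℂ} (c : Fin 3 → ℂ) {a : C3} (hη : DifferentiableAt ℝ η a)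
    (hθ : ∀ i, DifferentiableAt ℝ (θ i) a) :
    antiPart j (flatExtDeriv (fun y => η y - ∑ i, c i • θ i y) a) =
      antiPart j (flatExtDeriv η a) - ∑ i, c i • antiPart j (flatExtDeriv (θ i) a) := by
  have h : fderiv ℝ (fun y => η y - ∑ i, c i • θ i y) a =
      fderiv ℝ η a - ∑ i, c i • fderiv ℝ (θ i) a := by
    have hs : ∀ i, HasFDerivAt (fun y => c i • θ i y) (c i • fderiv ℝ (θ i) a) a := fun i =>
      (hθ i).hasFDerivAt.fun_const_smul (c i)
    exact (hη.hasFDerivAt.sub (HasFDerivAt.fun_sum fun i _ => hs i)).fderiv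
  ext v w
  simp only [antiPart, flatExtDeriv, h]
  simp only [antiPart, flatExtDeriv, Fin.sum_univ_three, Pi.sub_apply, Pi.add_apply,
    Pi.smul_apply, sub_apply, add_apply, smul_apply, smul_eq_mul]
  ring

/-- The operator `π^{0,2} ∘ d` on `(1,0)`-forms is tensorial: it annihilates at `a` every
`(1,0)`-form that vanishes at `a`, because the derivative of such a form at `a` takes values in
`(1,0)`-covectors. -/
theorem antiPart_flatExtDeriv_eq_zero {j : C3 → C3 →L[ℝ] C3} {η : C3 → C3 →L[ℝ] ℂ} {a : C3}
    (hj : DifferentiableAt ℝ j a) (hη : DifferentiableAt ℝ η a) (h0 : η a = 0)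
    (h10 : ∀ᶠ y in 𝓝 a, ∀ v, η y (j y v) = Complex.I * η y v) :
    antiPart (j a) (flatExtDeriv η a) = 0 := by
  have key : ∀ v w, fderiv ℝ η a v (j a w) = Complex.I * fderiv ℝ η a v w := by
    intro v w
    have h1 : HasFDerivAt (fun y => η y (j y w)) _ a :=
      hη.hasFDerivAt.clm_apply (hj.hasFDerivAt.clm_apply (hasFDerivAt_const w a))
    have h2 : HasFDerivAt (fun y => Complex.I * η y w) _ a :=
      (hη.hasFDerivAt.clm_apply (hasFDerivAt_const w a)).const_mul Complex.I
    have h3 := (h1.congr_of_eventuallyEq (h10.mono fun y hy => (hy w).symm)).unique h2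
    have h4 := DFunLike.congr_fun h3 v
    simpa [h0] using h4
  ext v w
  simp only [antiPart, flatExtDeriv, key, Pi.zero_apply]
  linear_combination (1 / 4 : ℂ) * (fderiv ℝ η a v w - fderiv ℝ η a w v) * Complex.I_mul_I

/-- Covectors of type `(1,0)` are combinations of the components of a coframe `σ` intertwining the
complex structure `j` with multiplication by `i`. -/
theorem exists_eq_sum_of_oneZero {j σ : C3 →L[ℝ] C3} (hσ : Function.Injective σ)
    (hj : ∀ v, σ (j v) = mulI (σ v)) {l : C3 →L[ℝ] ℂ} (hl : ∀ v, l (j v) = Complex.I * l v) :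
    ∃ c : Fin 3 → ℂ, l = ∑ i, c i • (ContinuousLinearMap.proj (R := ℝ) i).comp σ := by
  let e : C3 ≃ₗ[ℝ] C3 := LinearEquiv.ofInjectiveEndo (σ : C3 →ₗ[ℝ] C3) hσ
  have he : ∀ v, e v = σ v := fun v => rfl
  have hI : ∀ z : C3, l (e.symm (Complex.I • z)) = Complex.I * l (e.symm z) := by
    intro z
    rw [← hl]
    congr 1
    rw [LinearEquiv.symm_apply_eq, he, hj, ← he, LinearEquiv.apply_symm_apply, mulI]
  let L : C3 →ₗ[ℂ] ℂ :=
    { toFun := fun z => l (e.symm z)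
      map_add' := fun x y => by simp
      map_smul' := fun c z => by
        have : c • z = c.re • z + c.im • (Complex.I • z) := by
          ext k
          simp only [Pi.smul_apply, Pi.add_apply, smul_eq_mul, Complex.real_smul]
          nth_rewrite 1 [← Complex.re_add_im c]
          ring
        rw [this, map_add, map_smul, map_smul, map_add, map_smul, map_smul, hI]
        simp only [Complex.real_smul, RingHom.id_apply, smul_eq_mul]
        nth_rewrite 3 [← Complex.re_add_im c]
        ring }
  refine ⟨fun i => L (Pi.single i 1), ?_⟩
  ext v
  have h1 : l v = L (σ v) := by
    change l v = l (e.symm (σ v))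
    rw [← he, LinearEquiv.symm_apply_apply]
  rw [h1, LinearMap.pi_apply_eq_sum_univ L (σ v)]
  simp only [sum_apply, smul_apply,
    ContinuousLinearMap.comp_apply, ContinuousLinearMap.proj_apply, smul_eq_mul]
  refine Finset.sum_congr rfl fun i _ => ?_
  rw [mul_comm]
  congr 2
  ext k
  simp [Pi.single_apply, eq_comm]

namespace AlmostComplexStructure

variable {M : Type} [TopologicalSpace M] [ChartedSpace C3 M] [IsManifold 𝓘(ℝ, C3) ∞ M]

theorem inChart_base (J : AlmostComplexStructure M) (x : M) :
    J.inChart x (extChartAt 𝓘(ℝ, C3) x x) = J.toFun x := by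
  rw [inChart, mfderiv_extChartAt_symm_base, extChartAt_to_inv, mfderiv_extChartAt_base]
  rfl

theorem muBar_eq (J : AlmostComplexStructure M) (α : OneForm M) (x : M) :
    J.muBar α x =
      antiPart (J.toFun x) (flatExtDeriv (α.inChart x) (extChartAt 𝓘(ℝ, C3) x x)) := by
  have h : α.extDerivAt x = flatExtDeriv (α.inChart x) (extChartAt 𝓘(ℝ, C3) x x) := by
    ext v w
    simp only [OneForm.extDerivAt, mfderiv_extChartAt_base]
    rfl
  rw [muBar, h]
  rfl

theorem IsOneZeroOn.inChart {J : AlmostComplexStructure M} {α : OneForm M} {U : Set M}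
    (h : J.IsOneZeroOn α U) (x : M) {y : C3} (hy : y ∈ (extChartAt 𝓘(ℝ, C3) x).target)
    (hU : (extChartAt 𝓘(ℝ, C3) x).symm y ∈ U) (v : C3) :
    α.inChart x y (J.inChart x y v) = Complex.I * α.inChart x y v := by
  have h1 := h _ hU (mfderiv 𝓘(ℝ, C3) 𝓘(ℝ, C3) (extChartAt 𝓘(ℝ, C3) x).symm y v)
  refine Eq.trans ?_ h1
  have h2 := DFunLike.congr_fun (mfderiv_symm_comp_mfderiv_extChartAt x hy)
    (J.toFun _ (mfderiv 𝓘(ℝ, C3) 𝓘(ℝ, C3) (extChartAt 𝓘(ℝ, C3) x).symm y v))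
  exact congrArg (α ((extChartAt 𝓘(ℝ, C3) x).symm y)) h2

theorem isOneZeroOn_ofChart {J : AlmostComplexStructure M} (x : M) {η : C3 → C3 →L[ℝ] ℂ}
    (h : ∀ y ∈ (extChartAt 𝓘(ℝ, C3) x).target, ∀ v,
      η y (J.inChart x y v) = Complex.I * η y v) :
    J.IsOneZeroOn (OneForm.ofChart x η) (chartAt C3 x).source := by
  intro p hp v
  have hp' : p ∈ (extChartAt 𝓘(ℝ, C3) x).source := by rwa [extChartAt_source]
  have ht := (extChartAt 𝓘(ℝ, C3) x).map_source hp'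
  have h1 := h _ ht (mfderiv 𝓘(ℝ, C3) 𝓘(ℝ, C3) (extChartAt 𝓘(ℝ, C3) x) p v)
  have h2 := mfderiv_symm_comp_mfderiv_extChartAt x ht
  rw [inChart] at h1
  rw [(extChartAt 𝓘(ℝ, C3) x).left_inv hp'] at h1 h2
  refine Eq.trans ?_ h1
  have h3 : mfderiv 𝓘(ℝ, C3) 𝓘(ℝ, C3) (extChartAt 𝓘(ℝ, C3) x).symm
      (extChartAt 𝓘(ℝ, C3) x p) (mfderiv 𝓘(ℝ, C3) 𝓘(ℝ, C3) (extChartAt 𝓘(ℝ, C3) x) p v) = v :=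
    DFunLike.congr_fun h2 v
  exact congrArg (fun u => η (extChartAt 𝓘(ℝ, C3) x p)
    (mfderiv 𝓘(ℝ, C3) 𝓘(ℝ, C3) (extChartAt 𝓘(ℝ, C3) x) p (J.toFun p u))) h3.symm

/-- The image of `μ̄` at `x` is spanned by the values of `μ̄` on a local coframe of
`(1,0)`-forms, here given by the components of `σ` in the preferred chart at `x`. -/
theorem muBarRange_eq_span (J : AlmostComplexStructure M) (x : M) {σ : C3 → C3 →L[ℝ] C3}
    (hσ : ContDiff ℝ ∞ σ) (hinj : Function.Injective (σ (extChartAt 𝓘(ℝ, C3) x x)))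
    (hj : DifferentiableAt ℝ (J.inChart x) (extChartAt 𝓘(ℝ, C3) x x))
    (hJ : ∀ y ∈ (extChartAt 𝓘(ℝ, C3) x).target, ∀ v, σ y (J.inChart x y v) = mulI (σ y v)) :
    J.muBarRange x = Submodule.span ℂ (Set.range fun i : Fin 3 =>
      antiPart (J.inChart x (extChartAt 𝓘(ℝ, C3) x x))
        (flatExtDeriv (fun y => (ContinuousLinearMap.proj (R := ℝ) i).comp (σ y))
          (extChartAt 𝓘(ℝ, C3) x x))) := by
  set a := extChartAt 𝓘(ℝ, C3) x x with ha
  set θ : Fin 3 → C3 → C3 →L[ℝ] ℂ := fun i y =>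
    (ContinuousLinearMap.proj (R := ℝ) i).comp (σ y) with hθ
  have hat : ∀ᶠ y in 𝓝 a, y ∈ (extChartAt 𝓘(ℝ, C3) x).target := extChartAt_target_mem_nhds x
  have hθs : ∀ i, ContDiff ℝ ∞ (θ i) := fun i => contDiff_const.clm_comp hσ
  have hθd : ∀ i, DifferentiableAt ℝ (θ i) a := fun i =>
    ((hθs i).differentiable (by simp)) a
  have hθ10 : ∀ i, ∀ y ∈ (extChartAt 𝓘(ℝ, C3) x).target, ∀ v,
      θ i y (J.inChart x y v) = Complex.I * θ i y v := by
    intro i y hy v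
    simp [hθ, hJ y hy v, mulI]
  refine le_antisymm (Submodule.span_le.2 ?_) (Submodule.span_le.2 ?_)
  · rintro β ⟨U, α, hU, hxU, hs, h10, rfl⟩
    have hαd : DifferentiableAt ℝ (α.inChart x) a :=
      (hs.contDiffAt_inChart hU hxU).differentiableAt (by simp)
    have hcont : ∀ᶠ y in 𝓝 a, (extChartAt 𝓘(ℝ, C3) x).symm y ∈ U := by
      have := continuousAt_extChartAt_symm (I := 𝓘(ℝ, C3)) x
      refine this.preimage_mem_nhds ?_
      rw [extChartAt_to_inv]
      exact hU.mem_nhds hxU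
    have hα10 : ∀ᶠ y in 𝓝 a, ∀ v,
        α.inChart x y (J.inChart x y v) = Complex.I * α.inChart x y v := by
      filter_upwards [hat, hcont] with y hy hyU v
      exact h10.inChart x hy hyU v
    -- Subtract the combination of the `θ i` with constant coefficients that agrees with `α` at `x`.
    obtain ⟨c, hc⟩ := exists_eq_sum_of_oneZero hinj (hJ a hat.self_of_nhds) hα10.self_of_nhds
    have hz := antiPart_flatExtDeriv_eq_zero (j := J.inChart x)
      (η := fun y => α.inChart x y - ∑ i, c i • θ i y) hj
      (hαd.sub (DifferentiableAt.fun_sum fun i _ => (hθd i).fun_const_smul (c i)))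
      (by simp only [hc, hθ, sub_self]) (by
        filter_upwards [hat, hα10] with y hy hy' v
        simp only [sub_apply, sum_apply,
          smul_apply, hy', hθ10 _ y hy, mul_sub, Finset.mul_sum, smul_eq_mul]
        congr 1
        exact Finset.sum_congr rfl fun i _ => by ring)
    rw [antiPart_flatExtDeriv_sum _ c hαd hθd, sub_eq_zero] at hz
    have hmem : antiPart (J.inChart x a) (flatExtDeriv (α.inChart x) a) ∈
        Submodule.span ℂ (Set.range fun i : Fin 3 =>
          antiPart (J.inChart x a) (flatExtDeriv (θ i) a)) := by
      rw [hz]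
      exact (Submodule.mem_span_range_iff_exists_fun ℂ).2 ⟨c, rfl⟩
    have heq : J.muBar α x = antiPart (J.inChart x a) (flatExtDeriv (α.inChart x) a) := by
      rw [muBar_eq, ← inChart_base]
    exact Set.mem_of_eq_of_mem heq hmem
  · rintro _ ⟨i, rfl⟩
    have hmem : J.muBar (OneForm.ofChart x (θ i)) x ∈ J.muBarRange x :=
      Submodule.subset_span ⟨(chartAt C3 x).source, OneForm.ofChart x (θ i),
        (chartAt C3 x).open_source, mem_chart_source C3 x, OneForm.smoothOn_ofChart x (hθs i),
        isOneZeroOn_ofChart x (hθ10 i), rfl⟩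
    have hloc : (OneForm.ofChart x (θ i)).inChart x =ᶠ[𝓝 a] θ i :=
      hat.mono fun y hy => OneForm.inChart_ofChart x (θ i) hy
    have heq : antiPart (J.inChart x a) (flatExtDeriv (θ i) a) =
        J.muBar (OneForm.ofChart x (θ i)) x := by
      rw [muBar_eq, ← inChart_base, ← ha]
      unfold flatExtDeriv
      rw [hloc.fderiv_eq]
    exact Set.mem_of_eq_of_mem heq hmem

end AlmostComplexStructure

/-- If the members of `b` with index outside `S` vanish, and those with index in `S` are linearly
independent, the span of `b` has dimension `#S`. -/
theorem finrank_span_range_eq_card {V : Type*} [AddCommGroup V] [Module ℂ V] (b : Fin 3 → V)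
    (S : Finset (Fin 3)) (h0 : ∀ i ∉ S, b i = 0)
    (hS : ∀ c : Fin 3 → ℂ, ∑ i, c i • b i = 0 → ∀ i ∈ S, c i = 0) :
    Module.finrank ℂ (Submodule.span ℂ (Set.range b)) = S.card := by
  have hspan : Submodule.span ℂ (Set.range b) =
      Submodule.span ℂ (Set.range fun i : S => b i) := by
    refine le_antisymm (Submodule.span_le.2 ?_) (Submodule.span_mono ?_)
    · rintro _ ⟨i, rfl⟩
      by_cases hi : i ∈ S
      · exact Submodule.subset_span ⟨⟨i, hi⟩, rfl⟩
      · rw [h0 i hi]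
        exact Submodule.zero_mem _
    · rintro _ ⟨i, rfl⟩
      exact ⟨i, rfl⟩
  have hli : LinearIndependent ℂ fun i : S => b i := by
    rw [Fintype.linearIndependent_iff]
    intro g hg i
    have := hS (fun k => if hk : k ∈ S then g ⟨k, hk⟩ else 0) ?_ i i.2
    · simpa using this
    · rw [← hg, ← Finset.sum_subset (Finset.subset_univ S) fun k _ hk => by simp [hk],
        ← Finset.sum_coe_sort S]
      exact Finset.sum_congr rfl fun k _ => by simp
  rw [hspan, finrank_span_eq_card hli, Fintype.card_coe]

/-! ### Smooth families of almost complex structures -/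

section SmoothFamilies

variable {M : Type} [TopologicalSpace M] [ChartedSpace C3 M] [IsManifold 𝓘(ℝ, C3) ∞ M]

/-- A family of endomorphisms of the tangent bundle is jointly smooth in the parameter and in the
point as soon as its expressions in the preferred charts are. -/
theorem contMDiff_family_of_inChart {K : ℂ → C3 → C3 →L[ℝ] C3}
    (hK : ContDiff ℝ ∞ fun q : ℂ × C3 => K q.1 q.2)
    (T : ℂ → ∀ x : M, TangentSpace 𝓘(ℝ, C3) x →L[ℝ] TangentSpace 𝓘(ℝ, C3) x)
    (hT : ∀ s x₀ x, x ∈ (chartAt C3 x₀).source →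
      ((mfderiv 𝓘(ℝ, C3) 𝓘(ℝ, C3) (extChartAt 𝓘(ℝ, C3) x₀) x).comp (T s x)).comp
        (mfderiv 𝓘(ℝ, C3) 𝓘(ℝ, C3) (extChartAt 𝓘(ℝ, C3) x₀).symm
          (extChartAt 𝓘(ℝ, C3) x₀ x)) = K s (extChartAt 𝓘(ℝ, C3) x₀ x)) :
    ContMDiff (𝓘(ℝ, ℂ).prod 𝓘(ℝ, C3)) (𝓘(ℝ, C3).prod 𝓘(ℝ, C3 →L[ℝ] C3)) ∞
      (fun p : ℂ × M => Bundle.TotalSpace.mk' (C3 →L[ℝ] C3)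
        (E := fun x : M => TangentSpace 𝓘(ℝ, C3) x →L[ℝ] TangentSpace 𝓘(ℝ, C3) x)
        p.2 (T p.1 p.2)) := by
  rintro ⟨s₀, x₀⟩
  rw [contMDiffAt_hom_bundle]
  refine ⟨contMDiffAt_snd, ?_⟩
  have h1 : ContMDiffAt (𝓘(ℝ, ℂ).prod 𝓘(ℝ, C3)) 𝓘(ℝ, ℂ × C3) ∞
      (fun q : ℂ × M => (q.1, extChartAt 𝓘(ℝ, C3) x₀ q.2)) (s₀, x₀) :=
    contMDiffAt_fst.prodMk_space
      (ContMDiffAt.comp (s₀, x₀) (g := extChartAt 𝓘(ℝ, C3) x₀) (f := Prod.snd)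
        contMDiffAt_extChartAt contMDiffAt_snd)
  refine (hK.contMDiff.contMDiffAt.comp (s₀, x₀) h1).congr_of_eventuallyEq ?_
  have h2 : ∀ᶠ q : ℂ × M in 𝓝 (s₀, x₀), q.2 ∈ (chartAt C3 x₀).source :=
    continuousAt_snd.preimage_mem_nhds
      ((chartAt C3 x₀).open_source.mem_nhds (mem_chart_source C3 x₀))
  filter_upwards [h2] with q hq
  refine Eq.trans ?_ (hT q.1 x₀ q.2 hq)
  exact inCoordinates_end x₀ q.2 hq (T q.1 q.2)

end SmoothFamilies

section Convergence

theorem contDiff_iteratedFDeriv_family {P V E : Type*} [NormedAddCommGroup P] [NormedSpace ℝ P]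
    [NormedAddCommGroup V] [NormedSpace ℝ V] [NormedAddCommGroup E] [NormedSpace ℝ E]
    {K : P → V → E} (hK : ContDiff ℝ ∞ fun q : P × V => K q.1 q.2) (r : ℕ) :
    ContDiff ℝ ∞ fun q : P × V => iteratedFDeriv ℝ r (K q.1) q.2 := by
  induction r with
  | zero =>
    simp only [iteratedFDeriv_zero_eq_comp]
    exact (LinearIsometryEquiv.contDiff _).comp hK
  | succ r ih =>
    suffices hf : ContDiff ℝ ∞ fun q : P × V =>
        fderiv ℝ (iteratedFDeriv ℝ r (K q.1)) q.2 by
      exact ((continuousMultilinearCurryLeftEquiv ℝ (fun _ : Fin (r + 1) => V) E).symm :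
        _ →L[ℝ] (V [×(r + 1)]→L[ℝ] E)).contDiff.comp hf
    refine ContDiff.fderiv (f := fun (q : P × V) (z : V) => iteratedFDeriv ℝ r (K q.1) z)
      (g := fun q : P × V => q.2) (m := ∞) (n := ∞) ?_ contDiff_snd (by simp)
    exact ih.comp ((contDiff_fst.comp contDiff_fst).prodMk contDiff_snd)

variable {M : Type} [TopologicalSpace M] [ChartedSpace C3 M] [IsManifold 𝓘(ℝ, C3) ∞ M]

/-- A smooth family of almost complex structures is continuous for the `C^∞` topology. -/
theorem AlmostComplexStructure.tendsto_of_inChart {K : ℂ → C3 → C3 →L[ℝ] C3}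
    (hK : ContDiff ℝ ∞ fun q : ℂ × C3 => K q.1 q.2) {J : ℂ → AlmostComplexStructure M}
    (hJ : ∀ s x₀, ∀ y ∈ (extChartAt 𝓘(ℝ, C3) x₀).target, (J s).inChart x₀ y = K s y) :
    Filter.Tendsto J (𝓝 0) (𝓝 (J 0)) := by
  simp only [nhds_iInf, nhds_induced, Filter.tendsto_iInf, Filter.tendsto_comap_iff]
  intro x₀ r
  rw [UniformOnFun.tendsto_iff_tendstoUniformlyOn]
  rintro C ⟨hC, hCt⟩
  have heq : ∀ s, ∀ y ∈ C, iteratedFDeriv ℝ r ((J s).inChart x₀) y =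
      iteratedFDeriv ℝ r (K s) y := by
    intro s y hy
    refine (Filter.EventuallyEq.iteratedFDeriv ℝ ?_ r).self_of_nhds
    filter_upwards [(isOpen_extChartAt_target x₀).mem_nhds (hCt hy)] with z hz
    exact hJ s x₀ z hz
  have : CompactSpace C := isCompact_iff_compactSpace.1 hC
  have hu : TendstoUniformlyOn (fun s => iteratedFDeriv ℝ r (K s)) (iteratedFDeriv ℝ r (K 0))
      (𝓝 0) C := by
    rw [tendstoUniformlyOn_iff_tendstoUniformly_comp_coe]
    refine ContinuousOn.tendstoUniformly
      (f := fun (s : ℂ) (y : C) => iteratedFDeriv ℝ r (K s) y) Filter.univ_mem ?_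
    exact ((contDiff_iteratedFDeriv_family hK r).continuous.comp
      (continuous_id.prodMap continuous_subtype_val)).continuousOn
  exact (hu.congr (Filter.Eventually.of_forall fun s y hy => (heq s y hy).symm)).congr_right
    fun y hy => (heq 0 y hy).symm

end Convergence

/-! ### Descent to the quotient -/

section Descent

variable {G : Type} [Group G] [TopologicalSpace G] [ChartedSpace C3 G]
  [LieGroup 𝓘(ℝ, C3) ∞ G] [T2Space G] [LocallyCompactSpace G]

namespace LeftQuotient

/-- The charts of `Γ \ G` are local sections of the projection followed by charts of `G`; so the
inverse of a preferred chart is the projection, in the global coordinates `e` of `G`. -/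
theorem extChartAt_symm_eq {e : G ≃ₜ C3} (he : ∀ g : G, chartAt C3 g = e.toOpenPartialHomeomorph)
    (Γ : Subgroup G) [DiscreteTopology Γ] (x : LeftQuotient Γ) :
    ⇑(extChartAt 𝓘(ℝ, C3) x).symm = fun y => proj Γ (e.symm y) := by
  have := properlyDiscontinuousSMul_of_discrete Γ
  have := continuousConstSMul_of_lieGroup Γ
  have hl := (isQuotientCoveringMap_quotientMk_of_properlyDiscontinuousSMul
    (G := Γ) (E := G)).isCoveringMap.isLocalHomeomorph
  have h : ∃ a b : G, chartAt C3 x = (hl.localInverseAt a).trans (chartAt C3 b) := ⟨_, _, rfl⟩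
  obtain ⟨a, b, h⟩ := h
  funext y
  have h1 : ((hl.localInverseAt a).trans e.toOpenPartialHomeomorph).symm y =
      Quotient.mk (MulAction.orbitRel Γ G) (e.symm y) := by
    rw [OpenPartialHomeomorph.coe_trans_symm, Function.comp_apply,
      IsLocalHomeomorph.localInverseAt_symm]
    rfl
  rw [he b] at h
  exact (congrArg (fun c : OpenPartialHomeomorph (LeftQuotient Γ) C3 => c.symm y) h).trans h1

omit [TopologicalSpace G] [ChartedSpace C3 G] [LieGroup 𝓘(ℝ, C3) ∞ G] [T2Space G]
  [LocallyCompactSpace G]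

variable {Γ : Subgroup G}

theorem proj_mul (γ : Γ) (g : G) : proj Γ ((γ : G) * g) = proj Γ g :=
  Quotient.sound (s := MulAction.orbitRel Γ G) ⟨γ, rfl⟩

theorem exists_mul_eq_of_proj_eq {g h : G} (hgh : proj Γ g = proj Γ h) :
    ∃ γ : Γ, g = (γ : G) * h := by
  obtain ⟨γ, hγ⟩ := Quotient.exact hgh
  exact ⟨γ, hγ.symm⟩

end LeftQuotient

open LeftQuotient

/-- A field of endomorphisms of `Tℂ³` is invariant under the maps `L γ`. -/
def IsInvariantEnd {ι : Type*} (L : ι → C3 → C3) (K : C3 → C3 →L[ℝ] C3) : Prop :=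
  ∀ γ z, (K (L γ z)).comp (fderiv ℝ (L γ) z) = (fderiv ℝ (L γ) z).comp (K z)

variable {Γ : Subgroup G} [DiscreteTopology Γ]

/-- The value at `x ∈ Γ \ G` of the endomorphism field with expression `K` in the global
coordinates of `G`: the preferred chart at `x` is a local section of the projection, and it
identifies the tangent space at `x` with `ℂ³`. -/
def descendEnd (K : C3 → C3 →L[ℝ] C3) (x : LeftQuotient Γ) :
    TangentSpace 𝓘(ℝ, C3) x →L[ℝ] TangentSpace 𝓘(ℝ, C3) x :=
  K (extChartAt 𝓘(ℝ, C3) x x)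

variable {e : G ≃ₜ C3} {L : Γ → C3 → C3}

/-- The preferred chart at `[y]` and the global coordinates near `y` differ by a translation
`L γ` with `γ ∈ Γ`. As the preferred chart identifies the tangent space at `[y]` with `ℂ³`, the
derivative of the projection at `y` is that of `L γ`. -/
theorem exists_mfderiv_proj_eq (he : ∀ g : G, chartAt C3 g = e.toOpenPartialHomeomorph)
    (hL : ∀ (γ : Γ) g, e ((γ : G) * g) = L γ (e g)) (hLd : ∀ γ, Differentiable ℝ (L γ)) (y : C3) :
    ∃ γ : Γ, extChartAt 𝓘(ℝ, C3) (proj Γ (e.symm y)) (proj Γ (e.symm y)) = L γ y ∧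
      MDifferentiableAt 𝓘(ℝ, C3) 𝓘(ℝ, C3) (fun z => proj Γ (e.symm z)) y ∧
      mfderiv 𝓘(ℝ, C3) 𝓘(ℝ, C3) (fun z => proj Γ (e.symm z)) y = fderiv ℝ (L γ) y := by
  set x := proj Γ (e.symm y) with hx
  set a := extChartAt 𝓘(ℝ, C3) x x with ha
  have hsymm := extChartAt_symm_eq he Γ x
  have hpa : proj Γ (e.symm a) = x := by
    rw [ha]
    exact (congrFun hsymm _).symm.trans (extChartAt_to_inv x)
  obtain ⟨γ, hγ⟩ := exists_mul_eq_of_proj_eq (hpa.trans hx)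
  have haL : a = L γ y := by
    rw [← e.apply_symm_apply a, hγ, hL, e.apply_symm_apply]
  -- The projection is differentiable at `a`, as the inverse of the preferred chart at `x`, and
  -- invariance under `L γ` carries this over to `y`.
  have hpL : (fun z => proj Γ (e.symm z)) = (fun z => proj Γ (e.symm z)) ∘ L γ := by
    funext z
    have : e.symm (L γ z) = (γ : G) * e.symm z := by
      rw [Homeomorph.symm_apply_eq, hL, e.apply_symm_apply]
    simp only [Function.comp_apply, this, proj_mul]
  have : IsManifold 𝓘(ℝ, C3) 1 (LeftQuotient Γ) :=
    IsManifold.of_le (n := ∞) (by exact_mod_cast le_top)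
  have hd : MDifferentiableAt 𝓘(ℝ, C3) 𝓘(ℝ, C3) (fun z => proj Γ (e.symm z)) a := by
    rw [← hsymm]
    exact ((contMDiffOn_extChartAt_symm x).contMDiffAt
      (extChartAt_target_mem_nhds x)).mdifferentiableAt (n := 1) (by simp)
  have hid : mfderiv 𝓘(ℝ, C3) 𝓘(ℝ, C3) (fun z => proj Γ (e.symm z)) a =
      ContinuousLinearMap.id ℝ C3 := by
    rw [← hsymm]
    exact mfderiv_extChartAt_symm_base x
  rw [haL] at hd hid
  have hLm : MDifferentiableAt 𝓘(ℝ, C3) 𝓘(ℝ, C3) (L γ) y := (hLd γ y).mdifferentiableAt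
  have hcomp := mfderiv_comp (I'' := 𝓘(ℝ, C3)) y hd hLm
  refine ⟨γ, haL, ?_, ?_⟩
  · rw [hpL]
    exact hd.comp y hLm
  · rw [hpL, hcomp, mfderiv_eq_fderiv]
    ext1 v
    exact DFunLike.congr_fun hid (fderiv ℝ (L γ) y v)

theorem descendEnd_apply_mfderiv (he : ∀ g : G, chartAt C3 g = e.toOpenPartialHomeomorph)
    (hL : ∀ (γ : Γ) g, e ((γ : G) * g) = L γ (e g)) (hLd : ∀ γ, Differentiable ℝ (L γ))
    {K : C3 → C3 →L[ℝ] C3} (hK : IsInvariantEnd L K) (y v : C3) :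
    descendEnd K (proj Γ (e.symm y))
      (mfderiv 𝓘(ℝ, C3) 𝓘(ℝ, C3) (fun z => proj Γ (e.symm z)) y v) =
      mfderiv 𝓘(ℝ, C3) 𝓘(ℝ, C3) (fun z => proj Γ (e.symm z)) y (K y v) := by
  obtain ⟨γ, h1, -, h2⟩ := exists_mfderiv_proj_eq he hL hLd y
  rw [h2, descendEnd, h1]
  exact DFunLike.congr_fun (hK γ y) v

theorem descendEnd_inChart (he : ∀ g : G, chartAt C3 g = e.toOpenPartialHomeomorph)
    (hL : ∀ (γ : Γ) g, e ((γ : G) * g) = L γ (e g)) (hLd : ∀ γ, Differentiable ℝ (L γ))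
    {K : C3 → C3 →L[ℝ] C3} (hK : IsInvariantEnd L K) (x₀ : LeftQuotient Γ) {y : C3}
    (hy : y ∈ (extChartAt 𝓘(ℝ, C3) x₀).target) :
    ((mfderiv 𝓘(ℝ, C3) 𝓘(ℝ, C3) (extChartAt 𝓘(ℝ, C3) x₀)
        ((extChartAt 𝓘(ℝ, C3) x₀).symm y)).comp
      (descendEnd K ((extChartAt 𝓘(ℝ, C3) x₀).symm y))).comp
      (mfderiv 𝓘(ℝ, C3) 𝓘(ℝ, C3) (extChartAt 𝓘(ℝ, C3) x₀).symm y) = K y := by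
  have hid := mfderiv_extChartAt_comp_mfderiv_symm x₀ hy
  rw [extChartAt_symm_eq he Γ x₀] at hid ⊢
  ext1 v
  exact (congrArg _ (descendEnd_apply_mfderiv he hL hLd hK y v)).trans
    (DFunLike.congr_fun hid (K y v))

theorem contMDiff_descendEnd (he : ∀ g : G, chartAt C3 g = e.toOpenPartialHomeomorph)
    (hL : ∀ (γ : Γ) g, e ((γ : G) * g) = L γ (e g)) (hLd : ∀ γ, Differentiable ℝ (L γ))
    {K : ℂ → C3 → C3 →L[ℝ] C3} (hKs : ContDiff ℝ ∞ fun q : ℂ × C3 => K q.1 q.2)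
    (hK : ∀ s, IsInvariantEnd L (K s)) :
    ContMDiff (𝓘(ℝ, ℂ).prod 𝓘(ℝ, C3)) (𝓘(ℝ, C3).prod 𝓘(ℝ, C3 →L[ℝ] C3)) ∞
      (fun p : ℂ × LeftQuotient Γ => Bundle.TotalSpace.mk' (C3 →L[ℝ] C3)
        (E := fun x : LeftQuotient Γ =>
          TangentSpace 𝓘(ℝ, C3) x →L[ℝ] TangentSpace 𝓘(ℝ, C3) x)
        p.2 (descendEnd (K p.1) p.2)) := by
  refine contMDiff_family_of_inChart hKs (fun s x => descendEnd (K s) x) ?_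
  intro s x₀ x hx
  rw [← extChartAt_source 𝓘(ℝ, C3)] at hx
  have := descendEnd_inChart he hL hLd (hK s) x₀ ((extChartAt 𝓘(ℝ, C3) x₀).map_source hx)
  rwa [(extChartAt 𝓘(ℝ, C3) x₀).left_inv hx] at this

/-- The almost complex structure on `Γ \ G` induced by a `Γ`-invariant one on `G`, given by its
expression `K` in the global coordinates of `G`. -/
def AlmostComplexStructure.descend (he : ∀ g : G, chartAt C3 g = e.toOpenPartialHomeomorph)
    (hL : ∀ (γ : Γ) g, e ((γ : G) * g) = L γ (e g)) (hLd : ∀ γ, Differentiable ℝ (L γ))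
    (K : C3 → C3 →L[ℝ] C3) (hKs : ContDiff ℝ ∞ K) (hK : IsInvariantEnd L K)
    (hsq : ∀ z v, K z (K z v) = -v) : AlmostComplexStructure (LeftQuotient Γ) where
  toFun := descendEnd K
  sq_eq_neg _ v := hsq _ v
  smooth := (contMDiff_descendEnd he hL hLd (K := fun _ => K) (hKs.comp contDiff_snd)
    fun _ => hK).comp ((contMDiff_const (c := (0 : ℂ))).prodMk contMDiff_id)

end Descent

/-! ### Almost complex structures defined by coframes -/

/-- Multiplication by `i` as a continuous real-linear map. -/
def mulIL : C3 →L[ℝ] C3 :=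
  (Complex.I • ContinuousLinearMap.id ℂ C3).restrictScalars ℝ

theorem mulIL_apply (v : C3) : mulIL v = mulI v := rfl

theorem mulI_mulI (v : C3) : mulI (mulI v) = -v := by
  rw [mulI, mulI, smul_smul, Complex.I_mul_I, neg_one_smul]

/-- The complex structure on `ℂ³` for which the real-linear isomorphism `T` is complex linear,
the target carrying its standard complex structure. -/
def pullbackI (T : C3 →L[ℝ] C3) : C3 →L[ℝ] C3 := T.inverse.comp (mulIL.comp T)

theorem exists_continuousLinearEquiv_of_injective {T : C3 →L[ℝ] C3}
    (hT : Function.Injective T) : ∃ E : C3 ≃L[ℝ] C3, (E : C3 →L[ℝ] C3) = T :=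
  ⟨(LinearEquiv.ofInjectiveEndo (T : C3 →ₗ[ℝ] C3) hT).toContinuousLinearEquiv, rfl⟩

theorem apply_pullbackI {T : C3 →L[ℝ] C3} (hT : Function.Injective T) (v : C3) :
    T (pullbackI T v) = mulI (T v) := by
  obtain ⟨E, rfl⟩ := exists_continuousLinearEquiv_of_injective hT
  simp [pullbackI, mulIL_apply]

theorem pullbackI_sq {T : C3 →L[ℝ] C3} (hT : Function.Injective T) (v : C3) :
    pullbackI T (pullbackI T v) = -v := by
  apply hT
  rw [apply_pullbackI hT, apply_pullbackI hT, mulI_mulI, map_neg]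

theorem contDiff_pullbackI {P : Type*} [NormedAddCommGroup P] [NormedSpace ℝ P]
    {σ : P → C3 →L[ℝ] C3} (hσ : ContDiff ℝ ∞ σ) (hinj : ∀ q, Function.Injective (σ q)) :
    ContDiff ℝ ∞ fun q => pullbackI (σ q) := by
  have h1 : ContDiff ℝ ∞ fun q => (σ q).inverse := by
    rw [contDiff_iff_contDiffAt]
    intro q
    obtain ⟨E, hE⟩ := exists_continuousLinearEquiv_of_injective (hinj q)
    refine ContDiffAt.comp q (g := ContinuousLinearMap.inverse) ?_ hσ.contDiffAt
    rw [← hE]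
    exact contDiffAt_map_inverse E
  exact h1.clm_comp (contDiff_const.clm_comp hσ)

theorem isInvariantEnd_pullbackI {ι : Type*} {L : ι → C3 → C3} {σ : C3 → C3 →L[ℝ] C3}
    (hinj : ∀ z, Function.Injective (σ z))
    (hinv : ∀ γ z, (σ (L γ z)).comp (fderiv ℝ (L γ) z) = σ z) :
    IsInvariantEnd L fun z => pullbackI (σ z) := by
  intro γ z
  ext1 v
  apply hinj (L γ z)
  have h : ∀ w, σ (L γ z) (fderiv ℝ (L γ) z w) = σ z w := DFunLike.congr_fun (hinv γ z)
  simp only [ContinuousLinearMap.comp_apply]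
  rw [apply_pullbackI (hinj _), h, h, apply_pullbackI (hinj _)]

section Descent

open LeftQuotient

variable {G : Type} [Group G] [TopologicalSpace G] [ChartedSpace C3 G]
  [LieGroup 𝓘(ℝ, C3) ∞ G] [T2Space G] [LocallyCompactSpace G]
  {Γ : Subgroup G} [DiscreteTopology Γ] {e : G ≃ₜ C3} {L : Γ → C3 → C3}

theorem AlmostComplexStructure.ext_toFun {M : Type} [TopologicalSpace M] [ChartedSpace C3 M]
    [IsManifold 𝓘(ℝ, C3) ∞ M] {J J' : AlmostComplexStructure M} (h : J.toFun = J'.toFun) :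
    J = J' := by
  cases J; cases J'; cases h; rfl

/-- An almost complex structure is integrable if its expression in every preferred chart is
multiplication by `i`: the preferred charts are then holomorphic. -/
theorem AlmostComplexStructure.isIntegrable_of_inChart {M : Type} [TopologicalSpace M]
    [ChartedSpace C3 M] [IsManifold 𝓘(ℝ, C3) ∞ M] {J : AlmostComplexStructure M}
    (h : ∀ x₀, ∀ y ∈ (extChartAt 𝓘(ℝ, C3) x₀).target, J.inChart x₀ y = mulIL) :
    J.IsIntegrable := by
  intro x
  refine ⟨chartAt C3 x, IsManifold.chart_mem_maximalAtlas x, mem_chart_source C3 x, ?_⟩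
  intro p hp v
  have hp' : p ∈ (extChartAt 𝓘(ℝ, C3) x).source := by rwa [extChartAt_source]
  have ht := (extChartAt 𝓘(ℝ, C3) x).map_source hp'
  have h1 := h x _ ht
  have h2 := mfderiv_symm_comp_mfderiv_extChartAt x ht
  rw [inChart] at h1
  rw [(extChartAt 𝓘(ℝ, C3) x).left_inv hp'] at h1 h2
  have h3 : mfderiv 𝓘(ℝ, C3) 𝓘(ℝ, C3) (extChartAt 𝓘(ℝ, C3) x).symm
      (extChartAt 𝓘(ℝ, C3) x p) (mfderiv 𝓘(ℝ, C3) 𝓘(ℝ, C3) (extChartAt 𝓘(ℝ, C3) x) p v) = v :=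
    DFunLike.congr_fun h2 v
  have h4 := DFunLike.congr_fun h1
    (mfderiv 𝓘(ℝ, C3) 𝓘(ℝ, C3) (extChartAt 𝓘(ℝ, C3) x) p v)
  refine Eq.trans ?_ h4
  exact congrArg (fun u => mfderiv 𝓘(ℝ, C3) 𝓘(ℝ, C3) (extChartAt 𝓘(ℝ, C3) x) p
    (J.toFun p u)) h3.symm

theorem isStandard_of_descendEnd (he : ∀ g : G, chartAt C3 g = e.toOpenPartialHomeomorph)
    (hL : ∀ (γ : Γ) g, e ((γ : G) * g) = L γ (e g)) (hLd : ∀ γ, Differentiable ℝ (L γ))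
    (hK : IsInvariantEnd L fun _ => mulIL) {J : AlmostComplexStructure (LeftQuotient Γ)}
    (hJ : J.toFun = descendEnd fun _ => mulIL) : IsStandard J := by
  intro g v
  have : IsManifold 𝓘(ℝ, C3) ∞ G := ContMDiffMul.toIsManifold
  have : IsManifold 𝓘(ℝ, C3) 1 (LeftQuotient Γ) :=
    IsManifold.of_le (n := ∞) (by exact_mod_cast le_top)
  have hext : ⇑(extChartAt 𝓘(ℝ, C3) g) = e := by
    funext y
    have h1 : extChartAt 𝓘(ℝ, C3) g y = chartAt C3 g y := rfl
    rw [h1, he g]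
    rfl
  have hid := mfderiv_extChartAt_base g
  have hed : MDifferentiableAt 𝓘(ℝ, C3) 𝓘(ℝ, C3) e g := by
    rw [← hext]
    exact (contMDiffAt_extChartAt (n := 1)).mdifferentiableAt (by simp)
  rw [hext] at hid
  obtain ⟨-, -, hpd, -⟩ := exists_mfderiv_proj_eq he hL hLd (e g)
  have hp : proj Γ = (fun z => proj Γ (e.symm z)) ∘ e := by
    funext h
    simp
  have hcomp := mfderiv_comp (I'' := 𝓘(ℝ, C3)) g hpd hed
  rw [← hp] at hcomp
  have hd : ∀ w : C3, mfderiv 𝓘(ℝ, C3) 𝓘(ℝ, C3) (proj Γ) g w =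
      mfderiv 𝓘(ℝ, C3) 𝓘(ℝ, C3) (fun z => proj Γ (e.symm z)) (e g) w := by
    intro w
    refine (DFunLike.congr_fun hcomp w).trans ?_
    exact congrArg (mfderiv 𝓘(ℝ, C3) 𝓘(ℝ, C3) (fun z => proj Γ (e.symm z)) (e g))
      (DFunLike.congr_fun hid w)
  have key := descendEnd_apply_mfderiv he hL hLd hK (e g) v
  rw [hJ, hd, hd]
  rw [e.symm_apply_apply] at key
  exact key

/-- Invariant coframes `σ k s`, jointly smooth in the parameter `s` and the point, yield the
required curves of almost complex structures, provided that `σ k 0` is complex linear and that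
the `(0,2)`-components of the differentials of the components of `σ k s`, `s ≠ 0`, span a space of
dimension `k`. -/
theorem hasConstantRankCurves_of_coframes
    (he : ∀ g : G, chartAt C3 g = e.toOpenPartialHomeomorph)
    (hL : ∀ (γ : Γ) g, e ((γ : G) * g) = L γ (e g)) (hLd : ∀ γ, Differentiable ℝ (L γ))
    (σ : ℕ → ℂ → C3 → C3 →L[ℝ] C3)
    (hσ : ∀ k, ContDiff ℝ ∞ fun q : ℂ × C3 => σ k q.1 q.2)
    (hinj : ∀ k s z, Function.Injective (σ k s z))
    (hinv : ∀ k s γ z, (σ k s (L γ z)).comp (fderiv ℝ (L γ) z) = σ k s z)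
    (h0 : ∀ k z v, σ k 0 z (mulI v) = mulI (σ k 0 z v))
    (hrank : ∀ k ≤ 3, ∀ s ≠ 0, ∀ z, Module.finrank ℂ (Submodule.span ℂ
      (Set.range fun i : Fin 3 => antiPart (pullbackI (σ k s z)) (flatExtDeriv
        (fun y => (ContinuousLinearMap.proj (R := ℝ) i).comp (σ k s y)) z))) = k) :
    HasConstantRankCurves Γ := by
  have hKs : ∀ k, ContDiff ℝ ∞ fun q : ℂ × C3 => pullbackI (σ k q.1 q.2) := fun k =>
    contDiff_pullbackI (hσ k) fun q => hinj k q.1 q.2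
  have hKz : ∀ k s, ContDiff ℝ ∞ fun z => pullbackI (σ k s z) := fun k s =>
    (hKs k).comp (contDiff_const.prodMk contDiff_id)
  have hK : ∀ k s, IsInvariantEnd L fun z => pullbackI (σ k s z) := fun k s =>
    isInvariantEnd_pullbackI (hinj k s) (hinv k s)
  have hK0 : ∀ k, (fun z => pullbackI (σ k 0 z)) = fun _ => mulIL := by
    intro k
    funext z
    ext1 v
    apply hinj k 0 z
    rw [apply_pullbackI (hinj k 0 z), mulIL_apply, h0]
  let J : ℕ → ℂ → AlmostComplexStructure (LeftQuotient Γ) := fun k s =>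
    AlmostComplexStructure.descend he hL hLd (fun z => pullbackI (σ k s z)) (hKz k s) (hK k s)
      fun z => pullbackI_sq (hinj k s z)
  have hJc : ∀ k s x₀, ∀ y ∈ (extChartAt 𝓘(ℝ, C3) x₀).target,
      (J k s).inChart x₀ y = pullbackI (σ k s y) := fun k s x₀ y hy =>
    descendEnd_inChart he hL hLd (hK k s) x₀ hy
  have hJ0 : ∀ k, J k 0 = J 0 0 := by
    intro k
    apply AlmostComplexStructure.ext_toFun
    change descendEnd (fun z => pullbackI (σ k 0 z)) = descendEnd fun z => pullbackI (σ 0 0 z)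
    rw [hK0, hK0]
  have hrk : ∀ k ≤ 3, ∀ s ≠ 0, (J k s).HasConstantRank k := by
    intro k hk s hs x
    have hx := mem_extChartAt_target (I := 𝓘(ℝ, C3)) x
    rw [AlmostComplexStructure.rank,
      (J k s).muBarRange_eq_span x (σ := σ k s) ((hσ k).comp (contDiff_const.prodMk contDiff_id))
        (hinj k s _) ?_ ?_, hJc k s x _ hx]
    · exact hrank k hk s hs _
    · refine (((hKz k s).differentiable (by simp)) _).congr_of_eventuallyEq ?_
      filter_upwards [extChartAt_target_mem_nhds x] with y hy using hJc k s x y hy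
    · intro y hy v
      rw [hJc k s x y hy, apply_pullbackI (hinj k s y)]
  refine ⟨J 0 0, ?_, ?_, ?_, ?_⟩
  · refine isStandard_of_descendEnd he hL hLd ?_ ?_
    · rw [← hK0 0]
      exact hK 0 0
    · rw [← hK0 0]
      rfl
  · refine AlmostComplexStructure.isIntegrable_of_inChart fun x₀ y hy => ?_
    rw [hJc 0 0 x₀ y hy]
    exact congrFun (hK0 0) y
  · intro k hk
    exact ⟨1, one_pos, J k, (contMDiff_descendEnd he hL hLd (hKs k) (hK k)).contMDiffOn, hJ0 k,
      fun s hs _ => hrk k hk s hs⟩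
  · intro U hU k hk
    have ht := AlmostComplexStructure.tendsto_of_inChart (hKs k) (J := J k) (hJc k)
    rw [hJ0 k] at ht
    have h1 : ∀ᶠ s in 𝓝[≠] (0 : ℂ), J k s ∈ U := (ht.eventually hU).filter_mono nhdsWithin_le_nhds
    obtain ⟨s, hs, hs0⟩ := (h1.and self_mem_nhdsWithin).exists
    exact ⟨J k s, hs, hrk k hk s hs0⟩

end Descent

/-! ### Exterior calculus of 1-forms on `ℂ³` -/

/-- The wedge product of two covectors on `ℂ³`. -/
def wedge (α β : C3 →L[ℝ] ℂ) : C3 → C3 → ℂ := fun v w => α v * β w - α w * β v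

/-- The complex conjugate of a covector on `ℂ³`. -/
def conjForm (α : C3 →L[ℝ] ℂ) : C3 →L[ℝ] ℂ := Complex.conjCLE.toContinuousLinearMap.comp α

@[simp]
theorem conjForm_apply (α : C3 →L[ℝ] ℂ) (v : C3) : conjForm α v = conj (α v) := rfl

theorem contDiff_conjForm {P : Type*} [NormedAddCommGroup P] [NormedSpace ℝ P]
    {α : P → C3 →L[ℝ] ℂ} (hα : ContDiff ℝ ∞ α) : ContDiff ℝ ∞ fun q => conjForm (α q) :=
  contDiff_const.clm_comp hα

/-- The value of the complex linear extension of the covector `α` at the `(0,1)`-vector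
`v + i j v`. -/
def antiVal (j : C3 →L[ℝ] C3) (α : C3 →L[ℝ] ℂ) (v : C3) : ℂ := α v + Complex.I * α (j v)

theorem antiPart_wedge (j : C3 →L[ℝ] C3) (α β : C3 →L[ℝ] ℂ) (v w : C3) :
    antiPart j (wedge α β) v w =
      (1 / 4) * (antiVal j α v * antiVal j β w - antiVal j α w * antiVal j β v) := by
  simp only [antiPart, wedge, antiVal]
  linear_combination (-1 / 4 : ℂ) * (α (j v) * β (j w) - α (j w) * β (j v)) * Complex.I_mul_I

theorem antiPart_add (j : C3 →L[ℝ] C3) (β γ : C3 → C3 → ℂ) (v w : C3) :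
    antiPart j (β + γ) v w = antiPart j β v w + antiPart j γ v w := by
  simp only [antiPart, Pi.add_apply]
  ring

theorem antiPart_smul (j : C3 →L[ℝ] C3) (c : ℂ) (β : C3 → C3 → ℂ) (v w : C3) :
    antiPart j (c • β) v w = c * antiPart j β v w := by
  simp only [antiPart, Pi.smul_apply, smul_eq_mul]
  ring

theorem flatExtDeriv_const (α : C3 →L[ℝ] ℂ) (z : C3) : flatExtDeriv (fun _ => α) z = 0 := by
  ext v w
  simp [flatExtDeriv]

theorem flatExtDeriv_add {α β : C3 → C3 →L[ℝ] ℂ} {z : C3} (hα : DifferentiableAt ℝ α z)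
    (hβ : DifferentiableAt ℝ β z) : flatExtDeriv (fun y => α y + β y) z =
      flatExtDeriv α z + flatExtDeriv β z := by
  ext v w
  simp only [flatExtDeriv, fderiv_fun_add hα hβ, Pi.add_apply, add_apply]
  ring

theorem flatExtDeriv_smul {F : C3 → ℂ} {F' : C3 →L[ℝ] ℂ} {α : C3 → C3 →L[ℝ] ℂ} {z : C3}
    (hF : HasFDerivAt F F' z) (hα : DifferentiableAt ℝ α z) :
    flatExtDeriv (fun y => F y • α y) z = wedge F' (α z) + F z • flatExtDeriv α z := by
  ext v w
  have h := (hF.smul hα.hasFDerivAt).fderiv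
  simp only [flatExtDeriv, wedge, Pi.add_apply, Pi.smul_apply]
  have h' : fderiv ℝ (fun y => F y • α y) z = _ := h
  rw [h']
  simp
  ring

theorem flatExtDeriv_conjForm {α : C3 → C3 →L[ℝ] ℂ} {z : C3} (hα : DifferentiableAt ℝ α z)
    (v w : C3) : flatExtDeriv (fun y => conjForm (α y)) z v w =
      conj (flatExtDeriv α z v w) := by
  have h1 : HasFDerivAt (fun y => conjForm (α y)) _ z :=
    (hasFDerivAt_const Complex.conjCLE.toContinuousLinearMap z).clm_comp hα.hasFDerivAt
  simp only [flatExtDeriv, h1.fderiv, map_sub]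
  simp

theorem conj_wedge (α β : C3 →L[ℝ] ℂ) (v w : C3) :
    conj (wedge α β v w) = wedge (conjForm α) (conjForm β) v w := by
  simp [wedge]

/-! ### The holomorphic left-invariant coframe -/

/-- The `i`-th coordinate differential on `ℂ³`. -/
abbrev dz (i : Fin 3) : C3 →L[ℝ] ℂ := ContinuousLinearMap.proj i

/-- A family of holomorphic coframes on `ℂ³`: `dz₁`, `e^{-μ z₁} dz₂`, `e^{μ z₁} dz₃ - c z₁ dz₂`.
It is left-invariant on the vector group for `(c, μ) = (0, 0)`, on the complex Heisenberg group for
`(c, μ) = (1, 0)`, and on the Nakamura group for `(c, μ) = (0, 1)`. -/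
def holoForm (c μ : ℝ) (i : Fin 3) (z : C3) : C3 →L[ℝ] ℂ :=
  ![dz 0, Complex.exp (-μ * z 0) • dz 1, Complex.exp (μ * z 0) • dz 2 + (-(c * z 0)) • dz 1] i

theorem contDiff_holoForm (c μ : ℝ) (i : Fin 3) : ContDiff ℝ ∞ (holoForm c μ i) := by
  have h0 : ContDiff ℝ ∞ fun z : C3 => z 0 := contDiff_apply ℝ ℂ 0
  fin_cases i
  · exact contDiff_const
  · exact ((contDiff_const.mul h0).cexp).smul contDiff_const
  · exact (((contDiff_const.mul h0).cexp).smul contDiff_const).add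
      (((contDiff_const.mul h0).neg).smul contDiff_const)

theorem differentiableAt_holoForm (c μ : ℝ) (i : Fin 3) (z : C3) :
    DifferentiableAt ℝ (holoForm c μ i) z :=
  ((contDiff_holoForm c μ i).differentiable (by simp)) z

theorem hasFDerivAt_exp_mul (ν : ℂ) (i : Fin 3) (z : C3) :
    HasFDerivAt (fun y : C3 => Complex.exp (ν * y i)) ((Complex.exp (ν * z i) * ν) • dz i) z := by
  have h1 : HasFDerivAt (fun y : C3 => ν * y i) (ν • dz i) z :=
    ((dz i).hasFDerivAt (x := z)).const_mul ν
  have h2 := h1.cexp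
  rwa [smul_smul] at h2

theorem flatExtDeriv_holoForm_zero (c μ : ℝ) (z : C3) :
    flatExtDeriv (holoForm c μ 0) z = 0 :=
  flatExtDeriv_const _ z

theorem flatExtDeriv_holoForm_one (c μ : ℝ) (z : C3) :
    flatExtDeriv (holoForm c μ 1) z =
      (-μ : ℂ) • wedge (holoForm c μ 0 z) (holoForm c μ 1 z) := by
  have h := flatExtDeriv_smul (hasFDerivAt_exp_mul (-μ) 0 z)
    (differentiableAt_const (dz 1) (x := z))
  rw [flatExtDeriv_const, smul_zero, add_zero] at h
  refine h.trans ?_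
  ext v w
  simp [wedge, holoForm]
  ring

theorem flatExtDeriv_holoForm_two {c μ : ℝ} (hcμ : c = 0 ∨ μ = 0) (z : C3) :
    flatExtDeriv (holoForm c μ 2) z =
      (μ : ℂ) • wedge (holoForm c μ 0 z) (holoForm c μ 2 z) +
        (-c : ℂ) • wedge (holoForm c μ 0 z) (holoForm c μ 1 z) := by
  have h1 := flatExtDeriv_smul (hasFDerivAt_exp_mul μ 0 z)
    (differentiableAt_const (dz 2) (x := z))
  have hl : HasFDerivAt (fun y : C3 => -(c * y 0)) (-((c : ℂ) • dz 0)) z :=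
    (((dz 0).hasFDerivAt (x := z)).const_mul (c : ℂ)).neg
  have h2 := flatExtDeriv_smul hl (differentiableAt_const (dz 1) (x := z))
  have h := flatExtDeriv_add (α := fun y => Complex.exp (μ * y 0) • dz 2)
    (β := fun y => (-(c * y 0)) • dz 1) (z := z)
    ((hasFDerivAt_exp_mul μ 0 z).differentiableAt.smul (differentiableAt_const _))
    (hl.differentiableAt.smul (differentiableAt_const _))
  rw [h1, h2] at h
  simp only [flatExtDeriv_const, smul_zero, add_zero] at h
  refine h.trans ?_
  ext v w
  rcases hcμ with rfl | rfl
  · simp [wedge, holoForm]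
    ring
  · simp [wedge, holoForm]
    ring

/-! ### The deformed coframe -/

/-- The function `exp(2 i κ Re zᵢ)` of modulus one. -/
def phase (κ : ℝ) (i : Fin 3) (z : C3) : ℂ := Complex.exp (Complex.I * κ * (z i + conj (z i)))

theorem norm_phase (κ : ℝ) (i : Fin 3) (z : C3) : ‖phase κ i z‖ = 1 := by
  rw [phase, Complex.add_conj]
  have : Complex.I * κ * ((2 * (z i).re : ℝ) : ℂ) = ((κ * (2 * (z i).re) : ℝ) : ℂ) * Complex.I := by
    push_cast
    ring
  rw [this, Complex.norm_exp_ofReal_mul_I]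

theorem phase_ne_zero (κ : ℝ) (i : Fin 3) (z : C3) : phase κ i z ≠ 0 := Complex.exp_ne_zero _

theorem hasFDerivAt_phase (κ : ℝ) (i : Fin 3) (z : C3) :
    HasFDerivAt (phase κ i)
      ((phase κ i z * (Complex.I * κ)) • (dz i + conjForm (dz i))) z := by
  have h1 : HasFDerivAt (fun y : C3 => Complex.I * κ * (y i + conj (y i)))
      ((Complex.I * κ) • (dz i + conjForm (dz i))) z :=
    ((dz i + conjForm (dz i)).hasFDerivAt (x := z)).const_mul (Complex.I * κ)
  have h2 := h1.cexp
  rwa [smul_smul] at h2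

theorem contDiff_phase (κ : ℝ) (i : Fin 3) : ContDiff ℝ ∞ (phase κ i) := by
  have h : ContDiff ℝ ∞ fun y : C3 => y i + conj (y i) := (dz i + conjForm (dz i)).contDiff
  exact (contDiff_const.mul h).cexp

/-- A component of the deformed coframe: `φᵢ + r f φ̄ⱼ`, where `f` is the phase function of the
`l`-th coordinate and `r` a real coefficient. -/
def deformedForm (c μ κ : ℝ) (i j l : Fin 3) (r : ℝ) (z : C3) : C3 →L[ℝ] ℂ :=
  holoForm c μ i z + ((r : ℂ) * phase κ l z) • conjForm (holoForm c μ j z)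

theorem flatExtDeriv_deformedForm (c μ κ : ℝ) (i j l : Fin 3) (r : ℝ) (z v w : C3) :
    flatExtDeriv (deformedForm c μ κ i j l r) z v w = flatExtDeriv (holoForm c μ i) z v w +
      (r * phase κ l z) * (Complex.I * κ * (wedge (dz l) (conjForm (holoForm c μ j z)) v w +
        wedge (conjForm (dz l)) (conjForm (holoForm c μ j z)) v w) +
      conj (flatExtDeriv (holoForm c μ j) z v w)) := by
  have hd : DifferentiableAt ℝ (fun y => conjForm (holoForm c μ j y)) z :=
    ((contDiff_conjForm (contDiff_holoForm c μ j)).differentiable (by simp)) z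
  have hF := (hasFDerivAt_phase κ l z).const_mul (r : ℂ)
  have h := flatExtDeriv_add (differentiableAt_holoForm c μ i z)
    (hF.differentiableAt.smul hd)
  have h2 := flatExtDeriv_smul hF hd
  rw [show flatExtDeriv (deformedForm c μ κ i j l r) z = _ from h, Pi.add_apply, Pi.add_apply,
    show flatExtDeriv ((fun y => (r : ℂ) * phase κ l y) • fun y => conjForm (holoForm c μ j y)) z
      = _ from h2,
    Pi.add_apply, Pi.add_apply, Pi.smul_apply, Pi.smul_apply, flatExtDeriv_conjForm
      (differentiableAt_holoForm c μ j z)]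
  simp [wedge]
  ring

/-! ### The `(0,2)`-parts of the differentials of the deformed coframe -/

section Forms

variable {c μ κ : ℝ}

theorem flatExtDeriv_deformedForm_zero (r : ℝ) (z : C3) :
    flatExtDeriv (deformedForm c μ κ 0 1 0 r) z = (r * phase κ 0 z) •
      ((Complex.I * κ) • wedge (holoForm c μ 0 z) (conjForm (holoForm c μ 1 z)) +
        (Complex.I * κ - μ) •
          wedge (conjForm (holoForm c μ 0 z)) (conjForm (holoForm c μ 1 z))) := by
  ext v w
  rw [flatExtDeriv_deformedForm, flatExtDeriv_holoForm_zero, flatExtDeriv_holoForm_one]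
  simp only [Pi.smul_apply, Pi.add_apply, Pi.zero_apply, smul_eq_mul, map_mul, map_neg,
    Complex.conj_ofReal, conj_wedge]
  rw [show holoForm c μ 0 z = dz 0 from rfl]
  ring

theorem flatExtDeriv_deformedForm_one (hcμ : c = 0 ∨ μ = 0) (r : ℝ) (z : C3) :
    flatExtDeriv (deformedForm c μ κ 1 2 0 r) z =
      (-μ : ℂ) • wedge (holoForm c μ 0 z) (holoForm c μ 1 z) + (r * phase κ 0 z) •
      ((Complex.I * κ) • wedge (holoForm c μ 0 z) (conjForm (holoForm c μ 2 z)) +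
        (Complex.I * κ + μ) •
          wedge (conjForm (holoForm c μ 0 z)) (conjForm (holoForm c μ 2 z)) +
        (-c : ℂ) • wedge (conjForm (holoForm c μ 0 z)) (conjForm (holoForm c μ 1 z))) := by
  ext v w
  rw [flatExtDeriv_deformedForm, flatExtDeriv_holoForm_one, flatExtDeriv_holoForm_two hcμ]
  simp only [Pi.smul_apply, Pi.add_apply, smul_eq_mul, map_mul, map_neg, map_add,
    Complex.conj_ofReal, conj_wedge]
  rw [show holoForm c μ 0 z = dz 0 from rfl]
  ring

theorem flatExtDeriv_deformedForm_two (hcμ : c = 0 ∨ μ = 0) (hκμ : κ = 0 ∨ μ = 0) (r : ℝ)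
    (z : C3) : flatExtDeriv (deformedForm c μ κ 2 2 1 r) z =
      (μ : ℂ) • wedge (holoForm c μ 0 z) (holoForm c μ 2 z) +
      (-c : ℂ) • wedge (holoForm c μ 0 z) (holoForm c μ 1 z) + (r * phase κ 1 z) •
      ((Complex.I * κ) • wedge (holoForm c μ 1 z) (conjForm (holoForm c μ 2 z)) +
        (Complex.I * κ) • wedge (conjForm (holoForm c μ 1 z)) (conjForm (holoForm c μ 2 z)) +
        (μ : ℂ) • wedge (conjForm (holoForm c μ 0 z)) (conjForm (holoForm c μ 2 z)) +
        (-c : ℂ) • wedge (conjForm (holoForm c μ 0 z)) (conjForm (holoForm c μ 1 z))) := by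
  have h1 : κ = 0 ∨ holoForm c μ 1 z = dz 1 := by
    refine hκμ.imp_right ?_
    rintro rfl
    simp [holoForm]
  ext v w
  rw [flatExtDeriv_deformedForm, flatExtDeriv_holoForm_two hcμ]
  simp only [Pi.smul_apply, Pi.add_apply, smul_eq_mul, map_mul, map_neg, map_add,
    Complex.conj_ofReal, conj_wedge]
  rcases h1 with rfl | h1
  · simp only [Complex.ofReal_zero]
    ring
  · rw [h1]
    ring

variable {j : C3 →L[ℝ] C3} {z : C3} {ρ : Fin 3 → ℝ}

/-- The value at `(v, w)` of the product `qᵢ ∧ qₖ` of two of the functionals `q`. -/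
def minor (q : Fin 3 → C3 → ℂ) (i k : Fin 3) (v w : C3) : ℂ := q i v * q k w - q i w * q k v

/-- The values of the conjugate coframe on the `(0,1)`-vector `v + i j v`. -/
def antiCoord (j : C3 →L[ℝ] C3) (c μ : ℝ) (z : C3) (i : Fin 3) (v : C3) : ℂ :=
  antiVal j (conjForm (holoForm c μ i z)) v

theorem antiPart_deformedForm_zero
    (h0 : ∀ v, antiVal j (holoForm c μ 0 z) v = -(ρ 0 * phase κ 0 z) * antiCoord j c μ z 1 v)
    (v w : C3) :
    4 * antiPart j (flatExtDeriv (deformedForm c μ κ 0 1 0 (ρ 0)) z) v w =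
      (ρ 0 * phase κ 0 z) * (Complex.I * κ - μ) * minor (antiCoord j c μ z) 0 1 v w := by
  rw [flatExtDeriv_deformedForm_zero]
  simp only [antiPart_add, antiPart_smul, antiPart_wedge, h0]
  simp only [minor, antiCoord]
  ring

theorem antiPart_deformedForm_one (hcμ : c = 0 ∨ μ = 0)
    (h0 : ∀ v, antiVal j (holoForm c μ 0 z) v = -(ρ 0 * phase κ 0 z) * antiCoord j c μ z 1 v)
    (h1 : ∀ v, antiVal j (holoForm c μ 1 z) v = -(ρ 1 * phase κ 0 z) * antiCoord j c μ z 2 v)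
    (v w : C3) :
    4 * antiPart j (flatExtDeriv (deformedForm c μ κ 1 2 0 (ρ 1)) z) v w =
      (ρ 1 * phase κ 0 z) * ((Complex.I * κ + μ) * (minor (antiCoord j c μ z) 0 2 v w -
        ρ 0 * phase κ 0 z * minor (antiCoord j c μ z) 1 2 v w) -
        c * minor (antiCoord j c μ z) 0 1 v w) := by
  rw [flatExtDeriv_deformedForm_one hcμ]
  simp only [antiPart_add, antiPart_smul, antiPart_wedge, h0, h1]
  simp only [minor, antiCoord]
  ring

theorem antiPart_deformedForm_two (hcμ : c = 0 ∨ μ = 0) (hκμ : κ = 0 ∨ μ = 0)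
    (h0 : ∀ v, antiVal j (holoForm c μ 0 z) v = -(ρ 0 * phase κ 0 z) * antiCoord j c μ z 1 v)
    (h1 : ∀ v, antiVal j (holoForm c μ 1 z) v = -(ρ 1 * phase κ 0 z) * antiCoord j c μ z 2 v)
    (h2 : ∀ v, antiVal j (holoForm c μ 2 z) v = -(ρ 2 * phase κ 1 z) * antiCoord j c μ z 2 v)
    (v w : C3) :
    4 * antiPart j (flatExtDeriv (deformedForm c μ κ 2 2 1 (ρ 2)) z) v w =
      (ρ 2 * phase κ 1 z) * (μ * minor (antiCoord j c μ z) 0 2 v w -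
        c * minor (antiCoord j c μ z) 0 1 v w) +
      (ρ 2 * phase κ 1 z * (Complex.I * κ + μ * (ρ 0 * phase κ 0 z)) -
        c * (ρ 0 * phase κ 0 z) * (ρ 1 * phase κ 0 z)) *
        minor (antiCoord j c μ z) 1 2 v w := by
  rw [flatExtDeriv_deformedForm_two hcμ hκμ]
  simp only [antiPart_add, antiPart_smul, antiPart_wedge, h0, h1, h2]
  simp only [minor, antiCoord]
  ring

end Forms

/-! ### The coframe -/

/-- The deformed coframe `(φ₁ + ρ₁ f φ̄₂, φ₂ + ρ₂ f φ̄₃, φ₃ + ρ₃ g φ̄₃)`, where `φ` is the coframe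
`holoForm`, and `f` and `g` are the phase functions of the first two coordinates. -/
def coframe (c μ κ : ℝ) (ρ : Fin 3 → ℝ) (z : C3) : C3 →L[ℝ] C3 :=
  ContinuousLinearMap.pi ![deformedForm c μ κ 0 1 0 (ρ 0) z, deformedForm c μ κ 1 2 0 (ρ 1) z,
    deformedForm c μ κ 2 2 1 (ρ 2) z]

section Coframe

variable {c μ κ : ℝ} {ρ : Fin 3 → ℝ} {z : C3}

theorem eq_zero_of_add_mul_conj_eq_zero {x a : ℂ} (ha : ‖a‖ < 1) (h : x + a * conj x = 0) :
    x = 0 := by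
  by_contra hx
  have h1 : ‖x‖ = ‖a‖ * ‖x‖ :=
    calc ‖x‖ = ‖-(a * conj x)‖ := congrArg norm (eq_neg_of_add_eq_zero_left h)
      _ = ‖a‖ * ‖x‖ := by rw [norm_neg, norm_mul, RCLike.norm_conj]
  have h2 : 0 < ‖x‖ := norm_pos_iff.2 hx
  nlinarith

theorem eq_zero_of_holoForm_eq_zero {v : C3} (h : ∀ i, holoForm c μ i z v = 0) : v = 0 := by
  have h0 : v 0 = 0 := h 0
  have h1 : Complex.exp (-μ * z 0) * v 1 = 0 := h 1
  have h2 : Complex.exp (μ * z 0) * v 2 + -(c * z 0) * v 1 = 0 := h 2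
  have h1' := (mul_eq_zero.1 h1).resolve_left (Complex.exp_ne_zero _)
  rw [h1', mul_zero, add_zero] at h2
  have h2' := (mul_eq_zero.1 h2).resolve_left (Complex.exp_ne_zero _)
  ext i
  fin_cases i
  exacts [h0, h1', h2']

theorem coframe_injective (hρ : |ρ 2| < 1) : Function.Injective (coframe c μ κ ρ z) := by
  rw [injective_iff_map_eq_zero]
  intro v hv
  have h0 : holoForm c μ 0 z v + ρ 0 * phase κ 0 z * conj (holoForm c μ 1 z v) = 0 :=
    congrFun hv 0
  have h1 : holoForm c μ 1 z v + ρ 1 * phase κ 0 z * conj (holoForm c μ 2 z v) = 0 :=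
    congrFun hv 1
  have h2 : holoForm c μ 2 z v + ρ 2 * phase κ 1 z * conj (holoForm c μ 2 z v) = 0 :=
    congrFun hv 2
  -- The system is triangular, with a diagonal term only in the last component.
  have e2 := eq_zero_of_add_mul_conj_eq_zero (by
    rw [norm_mul, norm_phase, mul_one, Complex.norm_real]
    exact hρ) h2
  rw [e2, map_zero, mul_zero, add_zero] at h1
  rw [h1, map_zero, mul_zero, add_zero] at h0
  refine eq_zero_of_holoForm_eq_zero (c := c) (μ := μ) (z := z) fun i => ?_
  fin_cases i
  exacts [h0, h1, e2]

/-- On the `(0,1)`-vectors `v + i j v` the deformed coframe vanishes, which determines the values of the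
holomorphic coframe from those of its conjugate. -/
theorem antiVal_holoForm_add (hρ : |ρ 2| < 1) (v : C3) :
    antiVal (pullbackI (coframe c μ κ ρ z)) (holoForm c μ 0 z) v = -(ρ 0 * phase κ 0 z) *
        antiCoord (pullbackI (coframe c μ κ ρ z)) c μ z 1 v ∧
      antiVal (pullbackI (coframe c μ κ ρ z)) (holoForm c μ 1 z) v = -(ρ 1 * phase κ 0 z) *
        antiCoord (pullbackI (coframe c μ κ ρ z)) c μ z 2 v ∧
      antiVal (pullbackI (coframe c μ κ ρ z)) (holoForm c μ 2 z) v = -(ρ 2 * phase κ 1 z) *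
        antiCoord (pullbackI (coframe c μ κ ρ z)) c μ z 2 v := by
  have h := apply_pullbackI (coframe_injective (c := c) (μ := μ) (κ := κ) (z := z) hρ) v
  set u := pullbackI (coframe c μ κ ρ z) v with hu
  have h0 : holoForm c μ 0 z u + ρ 0 * phase κ 0 z * conj (holoForm c μ 1 z u) =
    Complex.I * (holoForm c μ 0 z v + ρ 0 * phase κ 0 z * conj (holoForm c μ 1 z v)) :=
    congrFun h 0
  have h1 : holoForm c μ 1 z u + ρ 1 * phase κ 0 z * conj (holoForm c μ 2 z u) =
    Complex.I * (holoForm c μ 1 z v + ρ 1 * phase κ 0 z * conj (holoForm c μ 2 z v)) :=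
    congrFun h 1
  have h2 : holoForm c μ 2 z u + ρ 2 * phase κ 1 z * conj (holoForm c μ 2 z u) =
    Complex.I * (holoForm c μ 2 z v + ρ 2 * phase κ 1 z * conj (holoForm c μ 2 z v)) :=
    congrFun h 2
  simp only [antiVal, antiCoord, conjForm_apply, ← hu]
  refine ⟨?_, ?_, ?_⟩
  · linear_combination Complex.I * h0 + (holoForm c μ 0 z v +
      ρ 0 * phase κ 0 z * conj (holoForm c μ 1 z v)) * Complex.I_mul_I
  · linear_combination Complex.I * h1 + (holoForm c μ 1 z v +
      ρ 1 * phase κ 0 z * conj (holoForm c μ 2 z v)) * Complex.I_mul_I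
  · linear_combination Complex.I * h2 + (holoForm c μ 2 z v +
      ρ 2 * phase κ 1 z * conj (holoForm c μ 2 z v)) * Complex.I_mul_I

/-- The antilinear coordinates `q` identify the tangent space with `ℂ³`. -/
theorem exists_antiCoord_eq (hρ : |ρ 2| < 1) (q : C3) :
    ∃ v, ∀ i, antiCoord (pullbackI (coframe c μ κ ρ z)) c μ z i v = q i := by
  set j := pullbackI (coframe c μ κ ρ z) with hj
  let Q : C3 →ₗ[ℝ] C3 :=
    { toFun := fun v i => antiCoord j c μ z i v
      map_add' := fun v w => by
        ext i
        simp only [antiCoord, antiVal, map_add, Pi.add_apply]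
        ring
      map_smul' := fun r v => by
        ext i
        simp only [antiCoord, antiVal, map_smul, Pi.smul_apply, Complex.real_smul,
          RingHom.id_apply]
        ring }
  -- If `q v = 0`, then `φ` vanishes on `v + i j v`, and by conjugation of `q` also on `v - i j v`;
  -- adding the two gives `φ v = 0`.
  have hQ : Function.Injective Q := by
    rw [injective_iff_map_eq_zero]
    intro v hv
    have hq : ∀ i, antiCoord j c μ z i v = 0 := congrFun hv
    obtain ⟨p0, p1, p2⟩ := antiVal_holoForm_add (c := c) (μ := μ) (κ := κ) (z := z) hρ v
    rw [← hj, hq, mul_zero] at p0 p1 p2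
    have hp : ∀ i, antiVal j (holoForm c μ i z) v = 0 := by
      intro i
      fin_cases i
      exacts [p0, p1, p2]
    refine eq_zero_of_holoForm_eq_zero (c := c) (μ := μ) (z := z) fun i => ?_
    have e1 := hp i
    have e2 := congrArg conj (hq i)
    simp only [antiCoord, antiVal, conjForm_apply, map_add, map_mul, Complex.conj_conj,
      Complex.conj_I, map_zero] at e1 e2
    linear_combination (1 / 2 : ℂ) * e1 + (1 / 2 : ℂ) * e2
  obtain ⟨v, hv⟩ := (LinearMap.injective_iff_surjective.1 hQ) q
  exact ⟨v, congrFun hv⟩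

end Coframe

/-! ### The rank -/

section Rank

variable {c μ κ : ℝ} {ρ : Fin 3 → ℝ}

/-- The structure constants `c`, `μ` and the frequency `κ` for which the deformed coframe is
generic: either the group is nilpotent and the phase functions are non-constant, of frequency at
least `|c|`, or it is the Nakamura group up to scaling and the phase functions are constant. -/
def IsAdmissible (c μ κ : ℝ) : Prop := (μ = 0 ∧ |c| ≤ κ ∧ 0 < κ) ∨ (κ = 0 ∧ c = 0 ∧ μ ≠ 0)

theorem proj_comp_coframe (z : C3) (i : Fin 3) :
    (ContinuousLinearMap.proj (R := ℝ) i).comp (coframe c μ κ ρ z) =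
      ![deformedForm c μ κ 0 1 0 (ρ 0) z, deformedForm c μ κ 1 2 0 (ρ 1) z,
        deformedForm c μ κ 2 2 1 (ρ 2) z] i := by
  rw [coframe, ContinuousLinearMap.proj_pi]

/-- This is the coefficient of the third unknown after elimination of the second one from the linear
relations between the `(0,2)`-parts of the three differentials. In the first admissible case its two
terms have different absolute values, since the phases have modulus one; in the second one it is
a single nonzero product. -/
theorem pivot_ne_zero (hadm : IsAdmissible c μ κ) {r₀ r₁ r₂ : ℝ} (h20 : r₀ ≠ 0)
    (h2 : |r₀ * r₁| < |r₂|) (z : C3) :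
    r₂ * phase κ 1 z * (Complex.I * κ + 2 * (μ * (r₀ * phase κ 0 z))) -
      c * (r₀ * phase κ 0 z) * (r₁ * phase κ 0 z) ≠ 0 := by
  have hr₂ : 0 < |r₂| := (abs_nonneg _).trans_lt h2
  rcases hadm with ⟨rfl, hc, hκ⟩ | ⟨rfl, rfl, hμ⟩
  · intro h
    have h' : (r₂ * phase κ 1 z * (Complex.I * κ) : ℂ) =
        c * (r₀ * phase κ 0 z) * (r₁ * phase κ 0 z) := by
      simp only [Complex.ofReal_zero] at h
      linear_combination h
    have hn := congrArg norm h'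
    simp only [norm_mul, norm_phase, Complex.norm_real, Complex.norm_I, Real.norm_eq_abs, mul_one,
      one_mul] at hn
    rw [abs_mul] at h2
    rw [abs_of_pos hκ] at hn
    have h3 : |c| * |r₀| * |r₁| ≤ κ * (|r₀| * |r₁|) := by
      rw [mul_assoc]
      exact mul_le_mul_of_nonneg_right hc (by positivity)
    nlinarith
  · have hr : (r₂ : ℂ) ≠ 0 := by
      simpa using abs_pos.1 hr₂
    have hr₀ : (r₀ : ℂ) ≠ 0 := by exact_mod_cast h20
    have hμ' : (μ : ℂ) ≠ 0 := by exact_mod_cast hμ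
    simp only [Complex.ofReal_zero, mul_zero, zero_mul, sub_zero, zero_add]
    exact mul_ne_zero (mul_ne_zero hr (phase_ne_zero _ _ _)) (mul_ne_zero two_ne_zero
      (mul_ne_zero hμ' (mul_ne_zero hr₀ (phase_ne_zero _ _ _))))

theorem I_mul_add_ne_zero (hadm : IsAdmissible c μ κ) :
    (Complex.I * κ + μ : ℂ) ≠ 0 ∧ (Complex.I * κ - μ : ℂ) ≠ 0 := by
  rcases hadm with ⟨rfl, -, hκ⟩ | ⟨rfl, -, hμ⟩
  · have : (κ : ℂ) ≠ 0 := by exact_mod_cast hκ.ne'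
    simp [this]
  · simp [hμ]

/-- The rank of the almost complex structure defined by the deformed coframe is the number of
nonzero coefficients. -/
theorem finrank_span_coframe (hadm : IsAdmissible c μ κ) (hρ : |ρ 2| < 1)
    (h21 : ρ 2 = 0 → ρ 1 = 0) (h20 : ρ 2 ≠ 0 → ρ 0 ≠ 0 ∧ |ρ 0 * ρ 1| < |ρ 2|) (z : C3) :
    Module.finrank ℂ (Submodule.span ℂ (Set.range fun i : Fin 3 =>
      antiPart (pullbackI (coframe c μ κ ρ z)) (flatExtDeriv
        (fun y => (ContinuousLinearMap.proj (R := ℝ) i).comp (coframe c μ κ ρ y)) z))) =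
      (Finset.univ.filter fun i => ρ i ≠ 0).card := by
  have hcμ : c = 0 ∨ μ = 0 := hadm.symm.imp (fun h => h.2.1) fun h => h.1
  have hκμ : κ = 0 ∨ μ = 0 := hadm.symm.imp (fun h => h.1) fun h => h.1
  set j := pullbackI (coframe c μ κ ρ z) with hj
  set b : Fin 3 → C3 → C3 → ℂ := fun i => antiPart j (flatExtDeriv
    (fun y => (ContinuousLinearMap.proj (R := ℝ) i).comp (coframe c μ κ ρ y)) z) with hb
  have hp := antiVal_holoForm_add (c := c) (μ := μ) (κ := κ) (z := z) hρ
  rw [← hj] at hp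
  have hp0 := fun v => (hp v).1
  have hp1 := fun v => (hp v).2.1
  have hp2 := fun v => (hp v).2.2
  have b0 := antiPart_deformedForm_zero hp0
  have b1 := antiPart_deformedForm_one hcμ hp0 hp1
  have b2 := antiPart_deformedForm_two hcμ hκμ hp0 hp1 hp2
  set q := antiCoord j c μ z with hq
  set f := phase κ 0 z with hf
  set g := phase κ 1 z with hg
  have hb0 : b 0 = antiPart j (flatExtDeriv (deformedForm c μ κ 0 1 0 (ρ 0)) z) := by
    simp only [hb, proj_comp_coframe]
    rfl
  have hb1 : b 1 = antiPart j (flatExtDeriv (deformedForm c μ κ 1 2 0 (ρ 1)) z) := by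
    simp only [hb, proj_comp_coframe]
    rfl
  have hb2 : b 2 = antiPart j (flatExtDeriv (deformedForm c μ κ 2 2 1 (ρ 2)) z) := by
    simp only [hb, proj_comp_coframe]
    rfl
  rw [← hb0] at b0
  rw [← hb1] at b1
  rw [← hb2] at b2
  obtain ⟨hpos, hneg⟩ := I_mul_add_ne_zero hadm
  have hf0 : f ≠ 0 := phase_ne_zero _ _ _
  refine finrank_span_range_eq_card b _ ?_ ?_
  · intro i hi
    have hi' : ρ i = 0 := by simpa using hi
    ext v w
    have h4 : (4 : ℂ) ≠ 0 := by norm_num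
    refine (mul_right_injective₀ h4) ?_
    simp only [Pi.zero_apply, mul_zero]
    fin_cases i
    · refine (b0 v w).trans ?_
      rw [show ρ 0 = 0 from hi', Complex.ofReal_zero]
      ring
    · refine (b1 v w).trans ?_
      rw [show ρ 1 = 0 from hi', Complex.ofReal_zero]
      ring
    · refine (b2 v w).trans ?_
      rw [h21 hi', show ρ 2 = 0 from hi', Complex.ofReal_zero]
      ring
  · intro a ha
    have key : ∀ v w, a 0 * (4 * b 0 v w) + a 1 * (4 * b 1 v w) + a 2 * (4 * b 2 v w) = 0 := by
      intro v w
      have h := congrFun (congrFun ha v) w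
      simp only [Fin.sum_univ_three, Pi.add_apply, Pi.smul_apply, smul_eq_mul,
        Pi.zero_apply] at h
      linear_combination 4 * h
    simp only [b0, b1, b2] at key
    -- Evaluate the relation on tangent vectors whose coordinates `q` are the standard basis vectors.
    have hex := exists_antiCoord_eq (c := c) (μ := μ) (κ := κ) (z := z) hρ
    rw [← hj, ← hq] at hex
    obtain ⟨v0, hv0⟩ := hex ![1, 0, 0]
    obtain ⟨v1, hv1⟩ := hex ![0, 1, 0]
    obtain ⟨v2, hv2⟩ := hex ![0, 0, 1]
    have k01 := key v0 v1
    have k02 := key v0 v2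
    have k12 := key v1 v2
    simp only [minor, hv0, hv1, hv2, Matrix.cons_val_zero, Matrix.cons_val_one,
      Matrix.cons_val] at k01 k02 k12
    have e2 : a 2 * ρ 2 = 0 := by
      by_cases hz : ρ 2 = 0
      · simp [hz]
      · have hX := pivot_ne_zero hadm (h20 hz).1 (h20 hz).2 z
        rw [← hf, ← hg] at hX
        have : a 2 * (ρ 2 * g * (Complex.I * κ + 2 * (μ * (ρ 0 * f))) -
            c * (ρ 0 * f) * (ρ 1 * f)) = 0 := by
          -- This combination eliminates `a 1`.
          linear_combination k12 + ρ 0 * f * k02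
        rw [(mul_eq_zero.1 this).resolve_right hX, zero_mul]
    have e1 : a 1 * ρ 1 = 0 := by
      have : a 1 * ρ 1 * (f * (Complex.I * κ + μ)) = 0 := by
        linear_combination k02 - g * μ * e2
      exact (mul_eq_zero.1 this).resolve_right (mul_ne_zero hf0 hpos)
    have e0 : a 0 * ρ 0 = 0 := by
      have : a 0 * ρ 0 * (f * (Complex.I * κ - μ)) = 0 := by
        linear_combination k01 + g * c * e2 + f * c * e1
      exact (mul_eq_zero.1 this).resolve_right (mul_ne_zero hf0 hneg)
    have e : ∀ i, a i * ρ i = 0 := by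
      intro i
      fin_cases i
      exacts [e0, e1, e2]
    intro i hi
    have hi' : ρ i ≠ 0 := by simpa using hi
    exact (mul_eq_zero.1 (e i)).resolve_right (by exact_mod_cast hi')

end Rank

/-! ### Invariance and dependence on the parameter -/

/-- The linear part of the left translation by `a` in the groups under consideration. -/
def translationLinear (c μ : ℝ) (a : C3) : C3 →L[ℝ] C3 :=
  ContinuousLinearMap.pi ![dz 0, Complex.exp (μ * a 0) • dz 1,
    Complex.exp (-μ * a 0) • dz 2 + (c * a 0) • dz 1]

/-- The left translation by `a`, an affine map, for the group with structure constants `c`, `μ`. -/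
def translation (c μ : ℝ) (a z : C3) : C3 := a + translationLinear c μ a z

theorem translation_eq (c μ : ℝ) (a z : C3) : translation c μ a z =
    ![a 0 + z 0, a 1 + Complex.exp (μ * a 0) * z 1,
      a 2 + (Complex.exp (-μ * a 0) * z 2 + c * a 0 * z 1)] := by
  ext i
  fin_cases i <;> simp [translation, translationLinear]

theorem hasFDerivAt_translation (c μ : ℝ) (a z : C3) :
    HasFDerivAt (translation c μ a) (translationLinear c μ a) z :=
  (translationLinear c μ a).hasFDerivAt.const_add a

theorem holoForm_translation {c μ : ℝ} (hcμ : c = 0 ∨ μ = 0) (a z : C3) (i : Fin 3) (w : C3) :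
    holoForm c μ i (translation c μ a z) (translationLinear c μ a w) = holoForm c μ i z w := by
  fin_cases i
  · simp [holoForm, translationLinear]
  · simp only [holoForm, translation, translationLinear]
    simp [mul_add, Complex.exp_add]
    rw [← mul_assoc, mul_comm (Complex.exp _), mul_assoc (Complex.exp _), ← Complex.exp_add]
    simp
  · rcases hcμ with rfl | rfl
    · simp only [holoForm, translation, translationLinear]
      simp [mul_add, Complex.exp_add]
      rw [← mul_assoc, mul_comm (Complex.exp _), mul_assoc (Complex.exp _), ← Complex.exp_add]
      simp
    · simp only [holoForm, translation, translationLinear]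
      simp
      ring

theorem phase_translation {c μ κ : ℝ} (hκμ : κ = 0 ∨ μ = 0) {a : C3}
    (h0 : phase κ 0 a = 1) (h1 : phase κ 1 a = 1) (z : C3) :
    phase κ 0 (translation c μ a z) = phase κ 0 z ∧
      phase κ 1 (translation c μ a z) = phase κ 1 z := by
  have hadd : ∀ (i : Fin 3) (x y : C3), phase κ i (x + y) = phase κ i x * phase κ i y := by
    intro i x y
    simp only [phase, Pi.add_apply, map_add, ← Complex.exp_add]
    congr 1
    ring
  rw [translation, hadd, hadd, h0, h1, one_mul, one_mul]
  refine ⟨by simp [phase, translationLinear], ?_⟩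
  rcases hκμ with rfl | rfl <;> simp [phase, translationLinear]

theorem coframe_translation {c μ κ : ℝ} (hcμ : c = 0 ∨ μ = 0) (hκμ : κ = 0 ∨ μ = 0) {a : C3}
    (h0 : phase κ 0 a = 1) (h1 : phase κ 1 a = 1) (ρ : Fin 3 → ℝ) (z : C3) :
    (coframe c μ κ ρ (translation c μ a z)).comp (translationLinear c μ a) =
      coframe c μ κ ρ z := by
  obtain ⟨e0, e1⟩ := phase_translation (c := c) hκμ h0 h1 z
  ext w i
  fin_cases i <;>
    simp [coframe, deformedForm, holoForm_translation hcμ, e0, e1]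

theorem contDiff_coframe {P : Type*} [NormedAddCommGroup P] [NormedSpace ℝ P] (c μ κ : ℝ)
    {ρ : P → Fin 3 → ℝ} (hρ : ContDiff ℝ ∞ ρ) :
    ContDiff ℝ ∞ fun q : P × C3 => coframe c μ κ (ρ q.1) q.2 := by
  have hd : ∀ (i j l m : Fin 3), ContDiff ℝ ∞ fun q : P × C3 =>
      deformedForm c μ κ i j l (ρ q.1 m) q.2 := by
    intro i j l m
    have hr : ContDiff ℝ ∞ fun q : P × C3 => ((ρ q.1 m : ℝ) : ℂ) :=
      Complex.ofRealCLM.contDiff.comp (((contDiff_pi.1 hρ) m).comp contDiff_fst)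
    exact ((contDiff_holoForm c μ i).comp contDiff_snd).add
      ((hr.mul ((contDiff_phase κ l).comp contDiff_snd)).smul
        (contDiff_conjForm ((contDiff_holoForm c μ j).comp contDiff_snd)))
  rw [contDiff_clm_apply_iff]
  intro w
  rw [contDiff_pi]
  intro i
  fin_cases i
  exacts [(hd 0 1 0 0).clm_apply contDiff_const, (hd 1 2 0 1).clm_apply contDiff_const,
    (hd 2 2 1 2).clm_apply contDiff_const]

theorem coframe_zero_mulI (c μ κ : ℝ) (z v : C3) :
    coframe c μ κ 0 z (mulI v) = mulI (coframe c μ κ 0 z v) := by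
  ext i
  fin_cases i <;> simp [coframe, deformedForm, holoForm, mulI] <;> ring

/-- The smooth function `|s|² / (1 + |s|²)`, with values in `[0, 1)` and vanishing only at `0`. -/
def size (s : ℂ) : ℝ := ‖s‖ ^ 2 / (1 + ‖s‖ ^ 2)

theorem contDiff_size : ContDiff ℝ ∞ size :=
  (contDiff_norm_sq ℝ).div (contDiff_const.add (contDiff_norm_sq ℝ)) fun s => by positivity

theorem size_nonneg (s : ℂ) : 0 ≤ size s := by unfold size; positivity

theorem size_lt_one (s : ℂ) : size s < 1 := by
  rw [size, div_lt_one (by positivity)]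
  linarith

theorem size_pos {s : ℂ} (hs : s ≠ 0) : 0 < size s := by
  have := norm_pos_iff.2 hs
  unfold size
  positivity

/-- The coefficients of the deformed coframe realizing rank `k`: `k` of them equal `t`, and the
others vanish. The first and the third are used before the second one, since on the Heisenberg
group the first two alone make the differential of the third form contribute to the rank. -/
def coeff (k : ℕ) (t : ℝ) : Fin 3 → ℝ :=
  ![if 1 ≤ k then t else 0, if 3 ≤ k then t else 0, if 2 ≤ k then t else 0]

theorem card_coeff_ne_zero {k : ℕ} (hk : k ≤ 3) {t : ℝ} (ht : t ≠ 0) :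
    (Finset.univ.filter fun i => coeff k t i ≠ 0).card = k := by
  rw [Finset.card_filter, Fin.sum_univ_three]
  interval_cases k <;> simp [coeff, ht]

theorem abs_coeff_size_lt_one (k : ℕ) (s : ℂ) (i : Fin 3) : |coeff k (size s) i| < 1 := by
  have h : ∀ (p : Prop) [Decidable p], |if p then size s else 0| < 1 := by
    intro p _
    split_ifs
    · rw [abs_of_nonneg (size_nonneg s)]
      exact size_lt_one s
    · simp
  fin_cases i
  exacts [h _, h _, h _]

theorem contDiff_coeff_size (k : ℕ) : ContDiff ℝ ∞ fun s => coeff k (size s) := by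
  rw [contDiff_pi]
  have h : ∀ (p : Prop) [Decidable p], ContDiff ℝ ∞ fun s => if p then size s else 0 := by
    intro p _
    by_cases hp : p
    · simpa [hp] using contDiff_size
    · simpa [hp] using contDiff_const
  intro i
  fin_cases i
  exacts [h _, h _, h _]

theorem finrank_span_coframe_coeff {c μ κ : ℝ} (hadm : IsAdmissible c μ κ) {k : ℕ} (hk : k ≤ 3)
    {s : ℂ} (hs : s ≠ 0) (z : C3) :
    Module.finrank ℂ (Submodule.span ℂ (Set.range fun i : Fin 3 =>
      antiPart (pullbackI (coframe c μ κ (coeff k (size s)) z)) (flatExtDeriv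
        (fun y => (ContinuousLinearMap.proj (R := ℝ) i).comp
          (coframe c μ κ (coeff k (size s)) y)) z))) = k := by
  have h1 := size_pos hs
  have h2 := size_lt_one s
  have h21 : coeff k (size s) 2 = 0 → coeff k (size s) 1 = 0 := by
    interval_cases k <;> simp [coeff]
  have h20 : coeff k (size s) 2 ≠ 0 → coeff k (size s) 0 ≠ 0 ∧
      |coeff k (size s) 0 * coeff k (size s) 1| < |coeff k (size s) 2| := by
    interval_cases k <;> simp [coeff, h1.ne']
    rw [abs_of_pos h1]
    nlinarith
  exact (finrank_span_coframe hadm (abs_coeff_size_lt_one k s 2) h21 h20 z).trans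
    (card_coeff_ne_zero hk h1.ne')

section Groups

variable {G : Type} [Group G] [TopologicalSpace G] [ChartedSpace C3 G]
  [LieGroup 𝓘(ℝ, C3) ∞ G] [T2Space G] [LocallyCompactSpace G]
  {Γ : Subgroup G} [DiscreteTopology Γ]

theorem hasConstantRankCurves_of_translation {c μ κ : ℝ} (hadm : IsAdmissible c μ κ) (e : G ≃ₜ C3)
    (he : ∀ g : G, chartAt C3 g = e.toOpenPartialHomeomorph)
    (hmul : ∀ g h : G, e (g * h) = translation c μ (e g) (e h))
    (hper : ∀ γ ∈ Γ, phase κ 0 (e γ) = 1 ∧ phase κ 1 (e γ) = 1) :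
    HasConstantRankCurves Γ := by
  have hcμ : c = 0 ∨ μ = 0 := hadm.symm.imp (fun h => h.2.1) fun h => h.1
  have hκμ : κ = 0 ∨ μ = 0 := hadm.symm.imp (fun h => h.1) fun h => h.1
  have hinv : ∀ (k : ℕ) (s : ℂ) (γ : Γ) (z : C3),
      (coframe c μ κ (coeff k (size s)) (translation c μ (e γ) z)).comp
        (fderiv ℝ (translation c μ (e γ)) z) = coframe c μ κ (coeff k (size s)) z := by
    intro k s γ z
    rw [(hasFDerivAt_translation c μ _ z).fderiv]
    obtain ⟨h0, h1⟩ := hper γ γ.2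
    exact coframe_translation hcμ hκμ h0 h1 _ z
  have h0 : ∀ k z v, coframe c μ κ (coeff k (size 0)) z (mulI v) =
      mulI (coframe c μ κ (coeff k (size 0)) z v) := by
    intro k z v
    have : coeff k (size 0) = 0 := by
      ext i
      fin_cases i <;> simp [coeff, size]
    rw [this]
    exact coframe_zero_mulI c μ κ z v
  have hsm : ∀ k : ℕ, ContDiff ℝ ∞ fun q : ℂ × C3 => coframe c μ κ (coeff k (size q.1)) q.2 :=
    fun k => contDiff_coframe (ρ := fun s => coeff k (size s)) c μ κ (contDiff_coeff_size k)
  exact hasConstantRankCurves_of_coframes (L := fun γ => translation c μ (e γ)) he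
    (fun γ g => hmul γ g) (fun γ z => (hasFDerivAt_translation c μ _ z).differentiableAt)
    (fun k s z => coframe c μ κ (coeff k (size s)) z)
    hsm (fun k s z => coframe_injective (abs_coeff_size_lt_one k s 2)) hinv h0
    fun k hk s hs z => finrank_span_coframe_coeff hadm hk hs z

end Groups

theorem phase_pi_of_mem_gaussianPoints {z : C3} (hz : z ∈ gaussianPoints) (i : Fin 3) :
    phase Real.pi i z = 1 := by
  obtain ⟨a, ha⟩ := hz i
  rw [phase, ha, Complex.add_conj, Complex.exp_eq_one_iff]
  refine ⟨a.re, ?_⟩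
  rw [← GaussianInt.intCast_re]
  push_cast
  ring

theorem VectorGroup.mul_eq_translation (g h : C3) :
    VectorGroup.mul g h = translation 0 0 g h := by
  rw [translation_eq]
  ext i
  fin_cases i <;> simp [VectorGroup.mul]

theorem ComplexHeisenberg.mul_eq_translation (g h : C3) :
    ComplexHeisenberg.mul g h = translation 1 0 g h := by
  rw [translation_eq]
  ext i
  fin_cases i <;> simp [ComplexHeisenberg.mul]
  ring

theorem NakamuraGroup.mul_eq_translation (g h : C3) :
    NakamuraGroup.mul g h = translation 0 1 g h := by
  rw [translation_eq]
  ext i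
  fin_cases i <;> simp [NakamuraGroup.mul]

/-- The torus `T⁶ = ℤ[i]³ \ ℂ³`, the Iwasawa manifold, and the holomorphically parallelizable
Nakamura manifold `Γ \ (ℂ ⋉ ℂ²)`, for any lattice `Γ` (discrete and cocompact subgroup). -/
theorem proposition3p4 :
    HasConstantRankCurves VectorGroup.lattice ∧
    HasConstantRankCurves ComplexHeisenberg.lattice ∧
    ∀ (Γ : Subgroup NakamuraGroup) [DiscreteTopology Γ] [CompactSpace (LeftQuotient Γ)],
      HasConstantRankCurves Γ := by
  refine ⟨?_, ?_, ?_⟩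
  · refine hasConstantRankCurves_of_translation (c := 0) (μ := 0) (κ := Real.pi)
      (Or.inl ⟨rfl, by simpa using Real.pi_pos.le, Real.pi_pos⟩)
      (G := VectorGroup) (Homeomorph.refl C3) (fun g => rfl) ?_ ?_
    · intro g h
      change VectorGroup.mul g h = translation 0 0 g h
      exact VectorGroup.mul_eq_translation g h
    · intro γ hγ
      exact ⟨phase_pi_of_mem_gaussianPoints hγ 0, phase_pi_of_mem_gaussianPoints hγ 1⟩
  · refine hasConstantRankCurves_of_translation (c := 1) (μ := 0) (κ := Real.pi)
      (Or.inl ⟨rfl, by rw [abs_one]; linarith [Real.pi_gt_three], Real.pi_pos⟩)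
      (G := ComplexHeisenberg) (Homeomorph.refl C3) (fun g => rfl) ?_ ?_
    · intro g h
      change ComplexHeisenberg.mul g h = translation 1 0 g h
      exact ComplexHeisenberg.mul_eq_translation g h
    · intro γ hγ
      exact ⟨phase_pi_of_mem_gaussianPoints hγ 0, phase_pi_of_mem_gaussianPoints hγ 1⟩
  · intro Γ _ _
    refine hasConstantRankCurves_of_translation (c := 0) (μ := 1) (κ := 0)
      (Or.inr ⟨rfl, rfl, one_ne_zero⟩)
      (G := NakamuraGroup) (Homeomorph.refl C3) (fun g => rfl) ?_ ?_
    · intro g h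
      change NakamuraGroup.mul g h = translation 0 1 g h
      exact NakamuraGroup.mul_eq_translation g h
    · intro γ _
      simp [phase]

end
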